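/- Let $\mathbb{F}_q$ be a finite field, $n\ge 0$, and fix a nontrivial homomorphism $\vartheta:\mathbb{F}_q^+\to\mathbb{C}^\times$. Let $\mathrm{UT}_n$ be the group of unipotent upper triangular matrices in $\mathrm{GL}_n(\mathbb{F}_q)$. **Normal pattern subgroups.** A normal pattern subgroup of $\mathrm{UT}_n$ is a normal subgroup $U$ of $\mathrm{UT}_n$ that is normalized by all invertible diagonal matrices; if $q=2$ it is moreover required that $U=\{u\in \mathrm{UT}_n : u_{ij}\ne 0,\ i<j \text{ imply } (i,j)\in D\}$ for some set $D$ of positions. For a composition $\alpha=(\alpha_1,\dots,\alpha_\ell)$ of $n$, let $U_\alpha\subseteq \mathrm{UT}_n$ be the group of block upper triangular matrices with diagonal blocks $\mathrm{Id}_{\alpha_1},\dots,\mathrm{Id}_{\alpha_\ell}$ and arbitrary entries above these blocks. **Set partitions.** A set partition $\eta$ of $\{1,\dots,n\}$ is a set of arcs $i\frown j$ with $1\le i<j\le n$ such that for any two arcs $i\frown k$, $j\frown l$ of $\eta$ one has $i=j$ if and only if $k=l$. It is non-nesting if it has no two arcs $i\frown l$, $j\frown k$ with $i<j<k<l$. Let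 $\mathrm{bl}(\eta)$ be the integer partition of $n$ formed by the sizes of the connected components of the graph on $\{1,\dots,n\}$ with edges the arcs of $\eta$. Let $u_\eta\in\mathrm{UT}_n$ be the matrix with entries $1$ on the diagonal and at the positions $(i,j)$ with $i\frown j\in\eta$, and $0$ elsewhere. Put $\gamma_\eta(u)=\prod_{i\frown j\in\eta}\vartheta(u_{ij})$, and let $\ker\gamma_\eta=\{u\in U:\gamma_\eta(u)=1\}$ on a subgroup $U$. **Generalized Gelfand–Graev characters.** Let $\lambda=(\lambda_1\ge\lambda_2\ge\cdots)$ be a partition of $n$ and $\lambda'$ its conjugate, whose parts are the column lengths of the Ferrers diagram of $\lambda$. Let $\mathrm{ctr}\in S_{\lambda_1}$ be given by $\mathrm{ctr}(j)=\lfloor\lambda_1/2\rfloor+1+\frac{j-1}{2}$ for odd $j$ and $\mathrm{ctr}(j)=\lfloor\lambda_1/2\rfloor+1-\frac j2$ for even $j$, and let $\mathrm{ctr}(\lambda')$ be the composition of $n$ whose part in position $\mathrm{ctr}(j)$ is $\lambda'_j$. Centre the rows of the Ferrers diagram of $\lambda$ (longest row at the top), so that horizontal positions are multiples of half a column, and number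 the cells $1,\dots,n$ down consecutive half-columns, going from left to right and in each half-column from top to bottom. Let $\mathrm{ggg}(\lambda)$ be the set partition with an arc $i\frown j$ ($i<j$) whenever $i$ and $j$ are the numbers of horizontally adjacent cells of the same row. The function $\gamma_\lambda=\gamma_{\mathrm{ggg}(\lambda)}$ is a linear character of $U_{\mathrm{ctr}(\lambda')}$, and $$\Gamma_\lambda=\mathrm{Ind}_{U_{\mathrm{ctr}(\lambda')}}^{\mathrm{GL}_n(\mathbb{F}_q)}(\gamma_\lambda)$$ denotes the character of the induced representation. **Statement.** Let $U$ be a normal pattern subgroup of $\mathrm{UT}_n$ and let $\eta$ be a non-nesting set partition of $\{1,\dots,n\}$ such that (a) $u_\eta\in U$; (b) $[U,U]\subseteq\ker\gamma_\eta$; (c) $U\subseteq U_\alpha$ for some composition $\alpha$ of $n$ that is a rearrangement of $\mathrm{bl}(\eta)'$. Then $\gamma_\eta$ is a linear character of $U$, and as characters of $\mathrm{GL}_n(\mathbb{F}_q)$ $$\mathrm{Ind}_U^{\mathrm{GL}_n(\mathbb{F}_q)}(\gamma_\eta)=\frac{|U_{\mathrm{ctr}(\mathrm{bl}(\eta)')}|}{|U|}\,\Gamma_{\mathrm{bl}(\eta)}.$$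 -/

import Mathlib

namespace GGG

open Finset

/-! ### Unipotent subgroups of the general linear group -/

/-- For a labelling `c` of the indices by natural numbers, the group of all `g ∈ GL_n(F)` such that
`(g - 1)_{ij} ≠ 0` implies `c i < c j`. -/
def unipotentOf {F : Type*} [Field F] [Finite F] {n : ℕ} (c : Fin n → ℕ) : Subgroup (GL (Fin n) F) :=
  let M : Submonoid (GL (Fin n) F) :=
    { carrier := {g | ∀ i j, ((g : Matrix (Fin n) (Fin n) F) - 1) i j ≠ 0 → c i < c j}
      one_mem' := by
        intro i j h
        simp at h
      mul_mem' := by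
        intro a b ha hb i j h
        have e : ((a * b : GL (Fin n) F) : Matrix (Fin n) (Fin n) F) - 1
            = (a.1 - 1) * (b.1 - 1) + (a.1 - 1) + (b.1 - 1) := by
          rw [Units.val_mul]; noncomm_ring
        by_contra hc
        have h1 : (a.1 - 1) i j = 0 := by
          by_contra h'; exact hc (ha i j h')
        have h2 : (b.1 - 1) i j = 0 := by
          by_contra h'; exact hc (hb i j h')
        apply h
        rw [e, Matrix.add_apply, Matrix.add_apply, h1, h2, Matrix.mul_apply, add_zero, add_zero]
        refine Finset.sum_eq_zero fun k _ => ?_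
        by_contra h'
        exact hc ((ha i k (left_ne_zero_of_mul h')).trans (hb k j (right_ne_zero_of_mul h'))) }
  { M with
    inv_mem' := by
      intro x hx
      have : x⁻¹ ∈ Submonoid.powers x :=
        (isOfFinOrder_of_finite x).mem_powers_iff_mem_zpowers.2
          (Subgroup.inv_mem _ (Subgroup.mem_zpowers x))
      exact (Submonoid.powers_le.2 hx : Submonoid.powers x ≤ M) this }

theorem mem_unipotentOf {F : Type*} [Field F] [Finite F] {n : ℕ} {c : Fin n → ℕ}
    {g : GL (Fin n) F} : g ∈ unipotentOf c ↔
      ∀ i j, ((g : Matrix (Fin n) (Fin n) F) - 1) i j ≠ 0 → c i < c j :=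
  Iff.rfl

/-- The group `UT_n(F)` of unipotent upper triangular matrices. -/
def UT (n : ℕ) (F : Type*) [Field F] [Finite F] : Subgroup (GL (Fin n) F) :=
  unipotentOf fun i => (i : ℕ)

/-- The group `U_α`, for a composition `α` of `n`: identity blocks of sizes `α_1, α_2, …` on the
diagonal, zeros below them, and arbitrary entries above them. -/
def UComp {n : ℕ} (F : Type*) [Field F] [Finite F] (α : Composition n) : Subgroup (GL (Fin n) F) :=
  unipotentOf fun i => (α.index i : ℕ)

/-- Normal pattern subgroups of `UT_n(F)`: the normal subgroups of `UT_n(F)` that are normalized by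
all invertible diagonal matrices. Over the field with two elements the diagonal group is trivial,
and there one asks explicitly that `U` consists of all the unipotent upper triangular matrices
whose nonzero entries above the diagonal lie in a given set `D` of positions. -/
structure IsNormalPattern {n : ℕ} {F : Type*} [Field F] [Finite F]
    (U : Subgroup (GL (Fin n) F)) : Prop where
  le_UT : U ≤ UT n F
  normal : UT n F ≤ Subgroup.normalizer (U : Set (GL (Fin n) F))
  torus : ∀ t : GL (Fin n) F, (t : Matrix (Fin n) (Fin n) F).IsDiag →
    t ∈ Subgroup.normalizer (U : Set (GL (Fin n) F))
  pattern : Nat.card F = 2 → ∃ D : Set (Fin n × Fin n), ∀ g ∈ UT n F,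
    (g ∈ U ↔ ∀ i j, i < j → (g : Matrix (Fin n) (Fin n) F) i j ≠ 0 → (i, j) ∈ D)

/-! ### Set partitions -/

/-- A set partition of `{1, …, n}` (indexed by `Fin n`), given by its arcs. -/
structure SetPartition (n : ℕ) where
  /-- The arcs; `(i, j)` stands for the arc from `i` to `j`. -/
  arcs : Finset (Fin n × Fin n)
  lt : ∀ p ∈ arcs, p.1 < p.2
  inj : ∀ p ∈ arcs, ∀ r ∈ arcs, p.1 = r.1 ↔ p.2 = r.2

namespace SetPartition

/-- There are no arcs `(i, l)` and `(j, k)` with `i < j < k < l`. -/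
def NonNesting {n : ℕ} (η : SetPartition n) : Prop :=
  ∀ i j k l : Fin n, (i, l) ∈ η.arcs → (j, k) ∈ η.arcs → ¬ (i < j ∧ j < k ∧ k < l)

/-- The equivalence relation whose classes are the blocks (connected components) of `η`. -/
def setoid {n : ℕ} (η : SetPartition n) : Setoid (Fin n) :=
  Relation.EqvGen.setoid fun i j => (i, j) ∈ η.arcs

open Classical in
/-- The integer partition `bl(η)` of `n` whose parts are the block sizes of `η`. -/
noncomputable def bl {n : ℕ} (η : SetPartition n) : n.Partition :=
  Nat.Partition.ofSums n ((Finpartition.ofSetoid η.setoid).parts.val.map Finset.card)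
    (by simpa using (Finpartition.ofSetoid η.setoid).sum_card_parts)

/-- The matrix `u_η`, with ones on the diagonal and at the arcs of `η`, and zeros elsewhere. -/
noncomputable def u {n : ℕ} (F : Type*) [Field F] (η : SetPartition n) : GL (Fin n) F :=
  Matrix.GeneralLinearGroup.mkOfDetNeZero
    (1 + Matrix.of fun i j => if (i, j) ∈ η.arcs then (1 : F) else 0) (by
      rw [Matrix.det_of_isUpperTriangular]
      · rw [Finset.prod_eq_one]
        · exact one_ne_zero
        · intro i _
          have : (i, i) ∉ η.arcs := fun h => lt_irrefl _ (η.lt _ h)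
          simp [this]
      · intro i j hij
        have h : (i, j) ∉ η.arcs := fun h => lt_asymm hij (η.lt _ h)
        have h' : i ≠ j := fun e => by subst e; exact lt_irrefl _ hij
        simp [h, h'])

/-- The function `γ_η`, sending `g` to the product of the `ϑ(g_{ij})` over the arcs `(i, j)`
of `η`. -/
noncomputable def γ {n : ℕ} {F : Type*} [Field F] (ϑ : AddChar F ℂ) (η : SetPartition n)
    (g : GL (Fin n) F) : ℂ :=
  ∏ p ∈ η.arcs, ϑ ((g : Matrix (Fin n) (Fin n) F) p.1 p.2)

end SetPartition

/-! ### Ferrers shapes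

Rows and columns are numbered from `0`. -/

/-- The Ferrers diagram of an integer partition: row `i` has as many cells as the `i`-th largest
part. -/
def diagram {n : ℕ} (lam : n.Partition) : YoungDiagram :=
  YoungDiagram.ofRowLens (lam.parts.sort (· ≥ ·)) (Multiset.pairwise_sort lam.parts (· ≥ ·)).sortedGE

theorem card_cellsOfRowLens (w : List ℕ) : (YoungDiagram.cellsOfRowLens w).card = w.sum := by
  induction w with
  | nil => simp [YoungDiagram.cellsOfRowLens]
  | cons a l ih =>
    rw [YoungDiagram.cellsOfRowLens, Finset.card_union_of_disjoint]
    · simp [ih]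
    · rw [Finset.disjoint_left]
      rintro ⟨x, y⟩ h1 h2
      simp at h1 h2
      omega

theorem card_diagram {n : ℕ} (lam : n.Partition) : (diagram lam).cells.card = n := by
  have h : (diagram lam).cells.card = (lam.parts.sort (· ≥ ·)).sum := card_cellsOfRowLens _
  rw [h, ← Multiset.sum_coe, Multiset.sort_eq, lam.parts_sum]

/-- The permutation `ctr` of the `m` columns, in coordinates starting from `0`: the columns with
odd number in the count from `1` are moved to the end in the same order, the others to the beginning
in reverse order. -/
def ctr (m : ℕ) : Equiv.Perm (Fin m) where
  toFun j := ⟨if (j : ℕ) % 2 = 0 then m / 2 + j / 2 else m / 2 - (j + 1) / 2, by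
    have := j.2; split_ifs <;> omega⟩
  invFun k := ⟨if m / 2 ≤ (k : ℕ) then 2 * (k - m / 2) else 2 * (m / 2 - k) - 1, by
    have := k.2; split_ifs <;> omega⟩
  left_inv j := by
    have := j.2
    ext
    dsimp only
    split_ifs <;> omega
  right_inv k := by
    have := k.2
    ext
    dsimp only
    split_ifs <;> omega

/-- The column lengths of `μ` after its columns have been permuted by `ctr`: the `j`-th column
moves to the position `ctr j`. -/
def ctrBlocks (μ : YoungDiagram) : List ℕ :=
  List.ofFn fun k : Fin (μ.rowLen 0) => μ.colLen ((ctr (μ.rowLen 0)).symm k)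

/-- The column of a cell of `μ` after the columns of `μ` have been permuted by `ctr` and the cells
of each row are listed from left to right. -/
def shiftCol (μ : YoungDiagram) (c : ℕ × ℕ) : ℕ :=
  μ.rowLen 0 / 2 - μ.rowLen c.1 / 2 + c.2

theorem card_shiftCol_eq (μ : YoungDiagram) (s : Fin (μ.rowLen 0)) :
    #{c ∈ μ.cells | shiftCol μ c = s} = μ.colLen ((ctr (μ.rowLen 0)).symm s) := by
  rw [← Finset.card_range (μ.colLen _)]
  have hs := s.2
  have key : ∀ r, (((ctr (μ.rowLen 0)).symm s : Fin _) : ℕ) < μ.rowLen r ↔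
      μ.rowLen 0 / 2 - μ.rowLen r / 2 ≤ s ∧
        (s : ℕ) - (μ.rowLen 0 / 2 - μ.rowLen r / 2) < μ.rowLen r := by
    intro r
    have := μ.rowLen_anti 0 r (Nat.zero_le _)
    have e : (((ctr (μ.rowLen 0)).symm s : Fin _) : ℕ) = if μ.rowLen 0 / 2 ≤ (s : ℕ) then
      2 * (s - μ.rowLen 0 / 2) else 2 * (μ.rowLen 0 / 2 - s) - 1 := rfl
    rw [e]
    split_ifs <;> omega
  refine Finset.card_bij (fun c _ => c.1) ?_ ?_ ?_
  · rintro ⟨r, k⟩ h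
    rw [mem_filter] at h
    simp only [YoungDiagram.mem_cells, YoungDiagram.mem_iff_lt_rowLen, shiftCol] at h
    change _ ∧ μ.rowLen 0 / 2 - μ.rowLen r / 2 + k = s at h
    change r ∈ _
    rw [Finset.mem_range, ← YoungDiagram.mem_iff_lt_colLen, YoungDiagram.mem_iff_lt_rowLen, key]
    omega
  · rintro ⟨r, k⟩ h ⟨r', k'⟩ h' e
    rw [mem_filter] at h h'
    simp only [shiftCol] at h h' e
    subst e
    ext
    · rfl
    · simp only
      omega
  · intro r h
    rw [Finset.mem_range, ← YoungDiagram.mem_iff_lt_colLen, YoungDiagram.mem_iff_lt_rowLen, key] at h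
    refine ⟨(r, s - (μ.rowLen 0 / 2 - μ.rowLen r / 2)), ?_, rfl⟩
    rw [mem_filter]
    simp only [YoungDiagram.mem_cells, YoungDiagram.mem_iff_lt_rowLen, shiftCol]
    omega

theorem shiftCol_lt (μ : YoungDiagram) {c : ℕ × ℕ} (hc : c ∈ μ) : shiftCol μ c < μ.rowLen 0 := by
  obtain ⟨r, k⟩ := c
  rw [YoungDiagram.mem_iff_lt_rowLen] at hc
  have := μ.rowLen_anti 0 r (Nat.zero_le _)
  simp only [shiftCol]
  omega

theorem card_shiftCol_lt (μ : YoungDiagram) (t : ℕ) (ht : t ≤ μ.rowLen 0) :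
    #{c ∈ μ.cells | shiftCol μ c < t} = ((ctrBlocks μ).take t).sum := by
  induction t with
  | zero => simp
  | succ t ih =>
    have hl : t < (ctrBlocks μ).length := by simpa [ctrBlocks] using ht
    rw [List.sum_take_succ _ _ hl, ← ih (by omega)]
    have e : (ctrBlocks μ)[t] = #{c ∈ μ.cells | shiftCol μ c = t} := by
      rw [card_shiftCol_eq μ ⟨t, ht⟩]
      simp [ctrBlocks]
    rw [e, ← Finset.card_union_of_disjoint]
    · congr 1
      ext c
      simp only [mem_filter, mem_union, ← and_or_left, Nat.lt_succ_iff_lt_or_eq]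
    · rw [Finset.disjoint_left]
      intro c h1 h2
      simp only [mem_filter] at h1 h2
      omega

theorem sum_ctrBlocks (μ : YoungDiagram) : (ctrBlocks μ).sum = μ.cells.card := by
  have h := card_shiftCol_lt μ _ le_rfl
  rw [List.take_of_length_le (by simp [ctrBlocks])] at h
  rw [← h, Finset.filter_true_of_mem]
  exact fun c hc => shiftCol_lt μ hc

/-- The composition `ctr(λ')`. -/
def ctrComp {n : ℕ} (lam : n.Partition) : Composition n where
  blocks := ctrBlocks (diagram lam)
  blocks_pos := by
    intro i hi
    obtain ⟨k, rfl⟩ := (List.mem_ofFn' _ _).1 hi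
    rw [← YoungDiagram.mem_iff_lt_colLen, YoungDiagram.mem_iff_lt_rowLen]
    exact Fin.is_lt _
  blocks_sum := by rw [sum_ctrBlocks, card_diagram]

/-- The reading order of the cells after the rows of `μ` have been centered. The first
coordinate is the horizontal position, in units of half a column; the second is the row. -/
def readKey (μ : YoungDiagram) (c : ℕ × ℕ) : ℕ ×ₗ ℕ :=
  toLex (μ.rowLen 0 - μ.rowLen c.1 + 2 * c.2, c.1)

/-- The number (starting from `0`) of a cell when the centered diagram is numbered down
consecutive half-columns, from left to right and in each of them from top to bottom. -/
def cellNum (μ : YoungDiagram) (c : ℕ × ℕ) : ℕ :=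
  #{d ∈ μ.cells | readKey μ d < readKey μ c}

theorem cellNum_lt_card {μ : YoungDiagram} {c : ℕ × ℕ} (hc : c ∈ μ) :
    cellNum μ c < μ.cells.card := by
  refine Finset.card_lt_card (Finset.filter_ssubset.2 ⟨c, hc, lt_irrefl _⟩)

theorem cellNum_lt {μ : YoungDiagram} {c d : ℕ × ℕ} (hc : c ∈ μ)
    (h : readKey μ c < readKey μ d) : cellNum μ c < cellNum μ d := by
  refine Finset.card_lt_card (Finset.ssubset_iff_of_subset ?_ |>.2 ⟨c, ?_, ?_⟩)
  · intro e he
    rw [mem_filter] at he ⊢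
    exact ⟨he.1, he.2.trans h⟩
  · rw [mem_filter]; exact ⟨hc, h⟩
  · rw [mem_filter]; exact fun h' => lt_irrefl _ h'.2

theorem cellNum_inj {μ : YoungDiagram} {c d : ℕ × ℕ} (hc : c ∈ μ) (hd : d ∈ μ)
    (h : cellNum μ c = cellNum μ d) : c = d := by
  have e : readKey μ c = readKey μ d := by
    rcases lt_trichotomy (readKey μ c) (readKey μ d) with h' | h' | h'
    · exact absurd h (cellNum_lt hc h').ne
    · exact h'
    · exact absurd h (cellNum_lt hd h').ne'
  have e' := toLex.injective e
  obtain ⟨r, k⟩ := c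
  obtain ⟨r', k'⟩ := d
  simp only [Prod.mk.injEq] at e'
  obtain ⟨h1, rfl⟩ := e'
  ext
  · rfl
  · simp only
    omega

/-- The arcs of `ggg(λ)`: they join the numbers of any two cells that are next to each other in a
row. Rows are shifted as a whole when one passes from the centered diagram to the one with columns
permuted by `ctr`, so the cells next to each other are the same for both. -/
def IsGggArc {n : ℕ} (lam : n.Partition) (i j : ℕ) : Prop :=
  ∃ r k : ℕ, (r, k + 1) ∈ diagram lam ∧
    i = cellNum (diagram lam) (r, k) ∧ j = cellNum (diagram lam) (r, k + 1)

theorem mem_of_succ_mem {μ : YoungDiagram} {r k : ℕ} (h : (r, k + 1) ∈ μ) : (r, k) ∈ μ :=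
  μ.up_left_mem le_rfl (Nat.le_succ k) h

open Classical in
/-- The set partition `ggg(λ)`. -/
noncomputable def ggg {n : ℕ} (lam : n.Partition) : SetPartition n where
  arcs := {p | IsGggArc lam p.1 p.2}
  lt := by
    rintro ⟨i, j⟩ h
    simp only [mem_filter, mem_univ, true_and] at h
    obtain ⟨r, k, h, hi, hj⟩ := h
    rw [Fin.lt_def, hi, hj]
    refine cellNum_lt (mem_of_succ_mem h) ?_
    rw [readKey, readKey, Prod.Lex.toLex_lt_toLex]
    left
    simp only
    omega
  inj := by
    rintro ⟨i, j⟩ h ⟨i', j'⟩ h'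
    simp only [mem_filter, mem_univ, true_and] at h h'
    obtain ⟨r, k, h, hi, hj⟩ := h
    obtain ⟨r', k', h', hi', hj'⟩ := h'
    simp only [Fin.ext_iff]
    constructor
    · intro e
      have := cellNum_inj (mem_of_succ_mem h) (mem_of_succ_mem h') (by rw [← hi, ← hi', e])
      simp only [Prod.mk.injEq] at this
      rw [hj, hj', this.1, this.2]
    · intro e
      have := cellNum_inj h h' (by rw [← hj, ← hj', e])
      simp only [Prod.mk.injEq, Nat.add_right_cancel_iff] at this
      rw [hi, hi', this.1, this.2]

theorem readKey_lt_of_shiftCol_lt {μ : YoungDiagram} {c d : ℕ × ℕ}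
    (h : shiftCol μ c < shiftCol μ d) : readKey μ c < readKey μ d := by
  have h1 := μ.rowLen_anti 0 c.1 (Nat.zero_le _)
  have h2 := μ.rowLen_anti 0 d.1 (Nat.zero_le _)
  rw [readKey, readKey, Prod.Lex.toLex_lt_toLex]
  left
  simp only [shiftCol] at h ⊢
  omega

theorem index_cellNum {n : ℕ} (lam : n.Partition) {c : ℕ × ℕ} (hc : c ∈ diagram lam) (i : Fin n)
    (hi : (i : ℕ) = cellNum (diagram lam) c) :
    ((ctrComp lam).index i : ℕ) = shiftCol (diagram lam) c := by
  have hs := shiftCol_lt _ hc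
  have h1 : (ctrComp lam).sizeUpTo (shiftCol (diagram lam) c) ≤ i := by
    rw [Composition.sizeUpTo, ctrComp, ← card_shiftCol_lt _ _ hs.le, hi]
    refine Finset.card_le_card fun d hd => ?_
    rw [mem_filter] at hd ⊢
    exact ⟨hd.1, readKey_lt_of_shiftCol_lt hd.2⟩
  have h2 : (i : ℕ) < (ctrComp lam).sizeUpTo (shiftCol (diagram lam) c + 1) := by
    rw [Composition.sizeUpTo, ctrComp, ← card_shiftCol_lt _ _ hs, hi]
    refine Finset.card_lt_card (Finset.ssubset_iff_of_subset ?_ |>.2 ⟨c, ?_, ?_⟩)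
    · intro d hd
      rw [mem_filter] at hd ⊢
      refine ⟨hd.1, ?_⟩
      by_contra h
      exact lt_asymm hd.2 (readKey_lt_of_shiftCol_lt (by omega))
    · rw [mem_filter]; exact ⟨hc, Nat.lt_succ_self _⟩
    · rw [mem_filter]; exact fun h => lt_irrefl _ h.2
  have h3 := (ctrComp lam).sizeUpTo_index_le i
  have h4 := (ctrComp lam).lt_sizeUpTo_index_succ i
  rcases lt_trichotomy ((ctrComp lam).index i : ℕ) (shiftCol (diagram lam) c) with h | h | h
  · have := (ctrComp lam).monotone_sizeUpTo (Nat.succ_le_of_lt h)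
    rw [Nat.succ_eq_add_one] at this
    rw [Fin.val_succ] at h4
    exact absurd (h4.trans_le this) (by omega)
  · exact h
  · have := (ctrComp lam).monotone_sizeUpTo (Nat.succ_le_of_lt h)
    rw [Nat.succ_eq_add_one] at this
    exact absurd (this.trans h3) (by omega)

theorem index_ggg {n : ℕ} (lam : n.Partition) {p : Fin n × Fin n} (hp : p ∈ (ggg lam).arcs) :
    ((ctrComp lam).index p.2 : ℕ) = (ctrComp lam).index p.1 + 1 := by
  simp only [ggg, mem_filter, mem_univ, true_and] at hp
  obtain ⟨r, k, h, hi, hj⟩ := hp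
  rw [index_cellNum lam h _ hj, index_cellNum lam (mem_of_succ_mem h) _ hi]
  simp only [shiftCol]
  omega

/-! ### Induced characters and generalized Gelfand–Graev characters -/

/-- The one-dimensional representation of a group afforded by a linear character. -/
def linRep {H : Type*} [Group H] (χ : H →* ℂ) : Representation ℂ H ℂ :=
  ((Algebra.lmul ℂ ℂ : ℂ →ₐ[ℂ] Module.End ℂ ℂ) : ℂ →* Module.End ℂ ℂ).comp χ

/-- The character of the representation of `G` induced from a linear character of a subgroup. -/
noncomputable def indChar {G : Type*} [Group G] (H : Subgroup G) (χ : H →* ℂ) : G → ℂ :=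
  (Representation.ind H.subtype (linRep χ)).character

/-- The linear character `γ_λ` of `U_{ctr(λ')}`, the restriction of `γ_{ggg(λ)}`. -/
noncomputable def gammaHom {n : ℕ} {F : Type*} [Field F] [Finite F] (ϑ : AddChar F ℂ)
    (lam : n.Partition) : UComp F (ctrComp lam) →* ℂ where
  toFun u := (ggg lam).γ ϑ (u : GL (Fin n) F)
  map_one' := by
    refine Finset.prod_eq_one fun p hp => ?_
    have := ((ggg lam).lt p hp).ne
    simp [this]
  map_mul' u v := by
    rw [SetPartition.γ, SetPartition.γ, SetPartition.γ, ← Finset.prod_mul_distrib]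
    refine Finset.prod_congr rfl fun p hp => ?_
    rw [← AddChar.map_add_eq_mul]
    congr 1
    have hne := ((ggg lam).lt p hp).ne
    have hidx := index_ggg lam hp
    have hu := mem_unipotentOf.1 u.2
    have hv := mem_unipotentOf.1 v.2
    have e : (((u * v : UComp F (ctrComp lam)) : GL (Fin n) F) : Matrix (Fin n) (Fin n) F) - 1
        = (u.1.1 - 1) * (v.1.1 - 1) + (u.1.1 - 1) + (v.1.1 - 1) := by
      rw [Subgroup.coe_mul, Units.val_mul]; noncomm_ring
    have e' := congrFun (congrFun e p.1) p.2
    have z : ((u.1.1 - 1) * (v.1.1 - 1)) p.1 p.2 = 0 := by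
      rw [Matrix.mul_apply]
      refine Finset.sum_eq_zero fun k _ => ?_
      by_contra h'
      have a1 := hu p.1 k (left_ne_zero_of_mul h')
      have a2 := hv k p.2 (right_ne_zero_of_mul h')
      omega
    simpa [z, Matrix.one_apply_ne hne] using e'

/-- The (character of the) generalized Gelfand–Graev representation `Γ_λ` of `GL_n(F)`, induced
from the linear character `γ_λ` of `U_{ctr(λ')}`. -/
noncomputable def Gam {n : ℕ} {F : Type*} [Field F] [Finite F] (ϑ : AddChar F ℂ)
    (lam : n.Partition) : GL (Fin n) F → ℂ :=
  indChar (UComp F (ctrComp lam)) (gammaHom ϑ lam)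

end GGG

namespace GGG

open Finset
open scoped commutatorElement

/-! ### The character of an induced representation -/

/-! Write q for the order of `F`, D for the positions allowed in `U` (an up-set, by
`IsNormalPattern.exists_upset`), W for its complement and E for the 0/1 matrix of the arcs of `η`.
By the Frobenius formula `indChar_apply`, the induced character at g is, up to 1/|U|, the sum of γ_η
over the conjugates xgx⁻¹ that lie in `U`. Fourier inversion over the entries in W turns each
summand into the average over Y in E + span W of ϑ(tr(Yᵀ(xgx⁻¹ - 1))). Summed over x, this is a
class function of Y, namely `orbitSum`. So the claim is about averages of class functions over
affine spaces of matrices.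

The core is `sum_affineOf_mul`: such an average over E + span W equals the average over the slice E
+ span S, where S consists of the positions (i, j) with i the end of a path of arcs and j no deeper
in its path than i. It needs S ⊆ W and a weight d on the indices for which arcs have degree 1 and
positions of W have degree less than 1. Every matrix unit is a commutator with E modulo span S, so
conjugation by suitable matrices 1 + cX, with X of negative degree, sweeps out one missing position
at a time, in order of increasing degree. In this way W and S both grow to the set of all positions
of degree less than 1 while the average stays the same.

Condition (a) puts the arcs into D; together with non-nesting it gives the weight
(`exists_grading`). Condition (c) gives S ⊆ W by counting vertices row by row
(`IsCellNumbering.index_le`). Condition (b) makes γ_η multiplicative (`exists_monoidHom_gamma`). The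
character Γ is the same construction for `ggg`, with the column as weight. Both families of paths
have their lengths given by `η.bl`, so a permutation matrix carries one slice to the other, and only
the factors 1/|U| and 1/|V|, with V the group inducing Γ, differ. -/

theorem trace_coinvariants {H V : Type*} [Group H] [Fintype H] [AddCommGroup V] [Module ℂ V]
    [FiniteDimensional ℂ V] (ρ : Representation ℂ H V) (f : V →ₗ[ℂ] V)
    (f' : ρ.Coinvariants →ₗ[ℂ] ρ.Coinvariants)
    (hf : f' ∘ₗ Representation.Coinvariants.mk ρ = Representation.Coinvariants.mk ρ ∘ₗ f) :
    LinearMap.trace ℂ _ f' =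
      (Fintype.card H : ℂ)⁻¹ * ∑ h : H, LinearMap.trace ℂ V (f ∘ₗ ρ h) := by
  have hcard : (Fintype.card H : ℂ) ≠ 0 := Nat.cast_ne_zero.2 Fintype.card_ne_zero
  -- The averaging operator is invariant under H, hence factors through the coinvariants as a
  -- section `s` of the quotient map; the trace of `f'` is then that of `f ∘ₗ P`.
  set P : V →ₗ[ℂ] V := (Fintype.card H : ℂ)⁻¹ • ∑ h : H, ρ h with hP
  have hPinv : ∀ x : H, P ∘ₗ ρ x = P := by
    intro x
    rw [hP, LinearMap.smul_comp]
    congr 1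
    ext v
    simp only [LinearMap.comp_apply, LinearMap.sum_apply]
    refine Fintype.sum_equiv (Equiv.mulRight x) _ _ fun h => ?_
    simp [map_mul]
  set s : ρ.Coinvariants →ₗ[ℂ] V := Representation.Coinvariants.lift ρ P hPinv with hs
  have h1 : Representation.Coinvariants.mk ρ ∘ₗ s = LinearMap.id := by
    apply Representation.Coinvariants.hom_ext
    ext v
    simp only [hs, hP, LinearMap.comp_apply, Representation.Coinvariants.lift_mk,
      LinearMap.smul_apply, LinearMap.sum_apply, map_smul, map_sum,
      Representation.Coinvariants.mk_self_apply, Finset.sum_const, Finset.card_univ,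
      LinearMap.id_apply]
    rw [← Nat.cast_smul_eq_nsmul ℂ, smul_smul, inv_mul_cancel₀ hcard, one_smul]
  have h2 : f' = (Representation.Coinvariants.mk ρ ∘ₗ f) ∘ₗ s := by
    rw [← hf, LinearMap.comp_assoc, h1, LinearMap.comp_id]
  rw [h2, LinearMap.comp_assoc, LinearMap.trace_comp_comm', LinearMap.comp_assoc]
  have h3 : s ∘ₗ Representation.Coinvariants.mk ρ = P := Representation.Coinvariants.lift_comp_mk _ _ _
  rw [h3, hP, LinearMap.comp_smul, map_smul, smul_eq_mul]
  have h4 : f ∘ₗ (∑ h : H, ρ h) = ∑ h : H, f ∘ₗ ρ h := by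
    ext v
    simp [LinearMap.sum_apply]
  rw [h4, map_sum]

open scoped MonoidAlgebra in
theorem trace_mapDomain {G : Type*} [Fintype G] [DecidableEq G] (f : G → G) :
    LinearMap.trace ℂ ℂ[G] (MonoidAlgebra.mapDomainLinearMap ℂ ℂ f) =
      ∑ x : G, if f x = x then 1 else 0 := by
  rw [LinearMap.trace_eq_matrix_trace ℂ (MonoidAlgebra.basis G ℂ), Matrix.trace]
  refine Finset.sum_congr rfl fun x _ => ?_
  rw [Matrix.diag_apply, LinearMap.toMatrix_apply, MonoidAlgebra.basis_apply]
  simp [MonoidAlgebra.basis, Finsupp.single_apply]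

-- The induced module is the space of H-coinvariants of ℂ[G] ⊗ ℂ, on which g acts by x ↦ x g⁻¹.
-- Composing with h ∈ H gives the permutation x ↦ h x g⁻¹ scaled by χ h, whose trace counts the x
-- with h = x g x⁻¹.
open Classical in
theorem indChar_apply {G : Type*} [Group G] [Fintype G] (H : Subgroup G) (χ : H →* ℂ) (g : G) :
    indChar H χ g = (Nat.card H : ℂ)⁻¹ *
      ∑ x : G, if h : x * g * x⁻¹ ∈ H then χ ⟨x * g * x⁻¹, h⟩ else 0 := by
  have : FiniteDimensional ℂ (MonoidAlgebra ℂ G) := Module.Finite.of_basis (MonoidAlgebra.basis G ℂ)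
  rw [indChar, Representation.character, trace_coinvariants _
    ((MonoidAlgebra.mapDomainLinearMap ℂ ℂ fun x => x * g⁻¹).rTensor ℂ)]
  swap
  · ext; simp
  rw [Nat.card_eq_fintype_card]
  congr 1
  have key : ∀ h : H, LinearMap.trace ℂ _
      (((MonoidAlgebra.mapDomainLinearMap ℂ ℂ fun x => x * g⁻¹).rTensor ℂ) ∘ₗ
        (Representation.tprod ((Representation.leftRegular ℂ G).comp H.subtype) (linRep χ)) h) =
      ∑ x : G, if (h : G) = x * g * x⁻¹ then χ h else 0 := by
    intro h
    have e : (((MonoidAlgebra.mapDomainLinearMap ℂ ℂ fun x => x * g⁻¹).rTensor ℂ) ∘ₗ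
        (Representation.tprod ((Representation.leftRegular ℂ G).comp H.subtype) (linRep χ)) h) =
        TensorProduct.map (MonoidAlgebra.mapDomainLinearMap ℂ ℂ fun x : G => h * x * g⁻¹)
          (χ h • LinearMap.id) := by
      ext x
      simp [linRep]
    rw [e, LinearMap.trace_tensorProduct', trace_mapDomain, map_smul, Finset.sum_mul]
    refine Finset.sum_congr rfl fun x _ => ?_
    have : (h : G) * x * g⁻¹ = x ↔ (h : G) = x * g * x⁻¹ := by
      rw [mul_inv_eq_iff_eq_mul, eq_mul_inv_iff_mul_eq]
    simp only [this]
    simp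
  rw [Finset.sum_congr rfl fun h _ => key h, Finset.sum_comm]
  refine Finset.sum_congr rfl fun x _ => ?_
  split_ifs with hx
  · rw [Finset.sum_eq_single ⟨_, hx⟩]
    · simp
    · intro b _ hb
      rw [if_neg]
      exact fun h => hb (Subtype.ext h)
    · simp
  · refine Finset.sum_eq_zero fun h _ => if_neg ?_
    rintro h'
    exact hx (h' ▸ h.2)

/-! ### Averages of class functions over affine spaces of matrices -/

/-! ### Matrices filtered by a weight on the indices -/

section Degree

variable {ι F : Type*} [Fintype ι] [DecidableEq ι] [Field F]

/-- All nonzero entries of `M` are in positions of degree at most `s`, where the position `(i, j)`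
has degree `d j - d i`. -/
def DegLE (d : ι → ℚ) (s : ℚ) (M : Matrix ι ι F) : Prop := ∀ i j, M i j ≠ 0 → d j - d i ≤ s

/-- All nonzero entries of `M` are in positions of degree less than `s`. -/
def DegLT (d : ι → ℚ) (s : ℚ) (M : Matrix ι ι F) : Prop := ∀ i j, M i j ≠ 0 → d j - d i < s

variable {d : ι → ℚ} {s t : ℚ} {M N : Matrix ι ι F}

omit [Fintype ι] [DecidableEq ι] in
theorem DegLT.le (h : DegLT d s M) : DegLE d s M := fun i j hij => (h i j hij).le

omit [Fintype ι] [DecidableEq ι] in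
theorem DegLE.lt (h : DegLE d s M) (hst : s < t) : DegLT d t M :=
  fun i j hij => (h i j hij).trans_lt hst

omit [Fintype ι] [DecidableEq ι] in
theorem DegLE.mono (h : DegLE d s M) (hst : s ≤ t) : DegLE d t M :=
  fun i j hij => (h i j hij).trans hst

omit [Fintype ι] [DecidableEq ι] in
theorem DegLE.add (hM : DegLE d s M) (hN : DegLE d s N) : DegLE d s (M + N) := by
  intro i j hij
  by_cases h : M i j = 0
  · exact hN i j fun h' => hij (by simp [h, h'])
  · exact hM i j h

omit [Fintype ι] [DecidableEq ι] in
theorem DegLT.add (hM : DegLT d s M) (hN : DegLT d s N) : DegLT d s (M + N) := by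
  intro i j hij
  by_cases h : M i j = 0
  · exact hN i j fun h' => hij (by simp [h, h'])
  · exact hM i j h

omit [Fintype ι] [DecidableEq ι] in
theorem DegLE.smul (hM : DegLE d s M) (c : F) : DegLE d s (c • M) :=
  fun i j hij => hM i j fun h => hij (by simp [h])

omit [Fintype ι] [DecidableEq ι] in
theorem DegLT.smul (hM : DegLT d s M) (c : F) : DegLT d s (c • M) :=
  fun i j hij => hM i j fun h => hij (by simp [h])

omit [Fintype ι] [DecidableEq ι] in
theorem DegLE.neg (hM : DegLE d s M) : DegLE d s (-M) :=
  fun i j hij => hM i j fun h => hij (by simp [h])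

omit [Fintype ι] [DecidableEq ι] in
theorem DegLT.neg (hM : DegLT d s M) : DegLT d s (-M) :=
  fun i j hij => hM i j fun h => hij (by simp [h])

omit [DecidableEq ι] in
theorem exists_ne_zero_of_mul {i j : ι} (h : (M * N) i j ≠ 0) : ∃ k, M i k ≠ 0 ∧ N k j ≠ 0 := by
  rw [Matrix.mul_apply] at h
  obtain ⟨k, -, hk⟩ := Finset.exists_ne_zero_of_sum_ne_zero h
  exact ⟨k, left_ne_zero_of_mul hk, right_ne_zero_of_mul hk⟩

omit [DecidableEq ι] in
theorem DegLE.mul (hM : DegLE d s M) (hN : DegLE d t N) : DegLE d (s + t) (M * N) := by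
  intro i j hij
  obtain ⟨k, h1, h2⟩ := exists_ne_zero_of_mul hij
  linarith [hM i k h1, hN k j h2]

omit [DecidableEq ι] in
theorem DegLE.mul_lt (hM : DegLE d s M) (hN : DegLT d t N) : DegLT d (s + t) (M * N) := by
  intro i j hij
  obtain ⟨k, h1, h2⟩ := exists_ne_zero_of_mul hij
  linarith [hM i k h1, hN k j h2]

omit [DecidableEq ι] in
theorem DegLT.mul_le (hM : DegLT d s M) (hN : DegLE d t N) : DegLT d (s + t) (M * N) := by
  intro i j hij
  obtain ⟨k, h1, h2⟩ := exists_ne_zero_of_mul hij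
  linarith [hM i k h1, hN k j h2]

omit [Fintype ι] in
theorem DegLE.one : DegLE d 0 (1 : Matrix ι ι F) := by
  intro i j hij
  have : i = j := by
    by_contra h
    exact hij (Matrix.one_apply_ne h)
  simp [this]

/-- `M` is strictly triangular for the weight: at an index of least weight in the support of a
kernel vector v, the entry of `M` v vanishes, which forces v to vanish there too. -/
theorem det_one_add_ne_zero (hs : s < 0) (hM : DegLE d s M) : (1 + M).det ≠ 0 := by
  classical
  intro h0
  obtain ⟨v, hv, h⟩ := Matrix.exists_mulVec_eq_zero_iff.2 h0
  obtain ⟨i0, hi0⟩ := Function.ne_iff.1 hv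
  obtain ⟨i, hi, hmin⟩ := Finset.exists_min_image (univ.filter fun i => v i ≠ 0) d
    ⟨i0, by simpa using hi0⟩
  simp only [mem_filter, mem_univ, true_and] at hi hmin
  have hr := congrFun h i
  rw [Matrix.add_mulVec, Matrix.one_mulVec, Pi.add_apply, Pi.zero_apply] at hr
  have : (M.mulVec v) i = 0 := by
    rw [Matrix.mulVec, dotProduct]
    refine Finset.sum_eq_zero fun j _ => ?_
    by_contra hj
    have h1 := hM i j (left_ne_zero_of_mul hj)
    have h2 := hmin j (right_ne_zero_of_mul hj)
    linarith
  rw [this, add_zero] at hr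
  exact hi hr

/-- In a finite group the inverse is a power, and degree at most 0 is preserved by products. -/
theorem DegLE.inv [Finite F] (g : GL ι F) (hg : DegLE d 0 (g : Matrix ι ι F)) :
    DegLE d 0 ((g⁻¹ : GL ι F) : Matrix ι ι F) := by
  let P : Submonoid (GL ι F) :=
    { carrier := {g | DegLE d 0 (g : Matrix ι ι F)}
      one_mem' := by
        simpa using (DegLE.one : DegLE d 0 (1 : Matrix ι ι F))
      mul_mem' := by
        intro a b ha hb
        simpa using DegLE.mul ha hb }
  have : g⁻¹ ∈ Submonoid.powers g :=
    (isOfFinOrder_of_finite g).mem_powers_iff_mem_zpowers.2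
      (Subgroup.inv_mem _ (Subgroup.mem_zpowers g))
  exact (Submonoid.powers_le.2 hg : Submonoid.powers g ≤ P) this

end Degree

/-- A disjoint union of directed paths with the arcs `arc`, where `a` counts the arcs of a path that
precede a vertex. -/
structure IsPaths {ι : Type*} (arc : ι → ι → Prop) (a : ι → ℕ) : Prop where
  right_unique : ∀ {x y z}, arc x y → arc x z → y = z
  left_unique : ∀ {x y z}, arc x z → arc y z → x = y
  depth : ∀ {x y}, arc x y → a y = a x + 1
  pred : ∀ {y}, a y ≠ 0 → ∃ x, arc x y

/-- The positions of the free entries in the transversal slice given by a union of paths. -/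
def IsSlicePos {ι : Type*} (arc : ι → ι → Prop) (a : ι → ℕ) (p : ι × ι) : Prop :=
  (∀ z, ¬ arc p.1 z) ∧ a p.2 ≤ a p.1

open Classical in
/-- The nilpotent matrix with ones at the arcs. -/
noncomputable def arcMatrix {ι : Type*} (F : Type*) [Field F] (arc : ι → ι → Prop) :
    Matrix ι ι F := Matrix.of fun i j => if arc i j then 1 else 0

/-! ### Commutators with the nilpotent matrix of a union of paths -/

section Commutator

variable {ι F : Type*} [Fintype ι] [DecidableEq ι] [Field F] {arc : ι → ι → Prop} {a : ι → ℕ}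

omit [Fintype ι] [DecidableEq ι] in
theorem arcMatrix_apply (i j : ι) [Decidable (arc i j)] :
    arcMatrix F arc i j = if arc i j then 1 else 0 := by
  simp [arcMatrix]

theorem arcMatrix_mul_single (h : IsPaths arc a) {w u : ι} (hw : arc w u) (v : ι) :
    arcMatrix F arc * Matrix.single u v 1 = Matrix.single w v 1 := by
  classical
  ext i j
  by_cases hj : v = j
  · subst hj
    rw [Matrix.mul_single_apply_same, arcMatrix_apply, mul_one, Matrix.single_apply]
    by_cases hi : w = i
    · subst hi; simp [hw]
    · have : ¬ arc i u := fun h' => hi (h.left_unique hw h')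
      simp [hi, this]
  · rw [Matrix.mul_single_apply_of_ne _ _ _ _ _ (Ne.symm hj), Matrix.single_apply]
    simp [hj]

theorem arcMatrix_mul_single_of_not {u : ι} (hw : ∀ w, ¬ arc w u) (v : ι) :
    arcMatrix F arc * Matrix.single u v 1 = 0 := by
  classical
  ext i j
  by_cases hj : v = j
  · subst hj
    rw [Matrix.mul_single_apply_same, arcMatrix_apply]
    simp [hw i]
  · rw [Matrix.mul_single_apply_of_ne _ _ _ _ _ (Ne.symm hj)]
    simp

theorem single_mul_arcMatrix (h : IsPaths arc a) {v z : ι} (hw : arc v z) (u : ι) :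
    Matrix.single u v 1 * arcMatrix F arc = Matrix.single u z 1 := by
  classical
  ext i j
  by_cases hi : u = i
  · subst hi
    rw [Matrix.single_mul_apply_same, arcMatrix_apply, one_mul, Matrix.single_apply]
    by_cases hj : z = j
    · subst hj; simp [hw]
    · have : ¬ arc v j := fun h' => hj (h.right_unique hw h')
      simp [hj, this]
  · rw [Matrix.single_mul_apply_of_ne _ _ _ _ _ (Ne.symm hi), Matrix.single_apply]
    simp [hi]

theorem single_mul_arcMatrix_of_not {v : ι} (hw : ∀ z, ¬ arc v z) (u : ι) :
    Matrix.single u v 1 * arcMatrix F arc = 0 := by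
  classical
  ext i j
  by_cases hi : u = i
  · subst hi
    rw [Matrix.single_mul_apply_same, arcMatrix_apply]
    simp [hw j]
  · rw [Matrix.single_mul_apply_of_ne _ _ _ _ _ (Ne.symm hi)]
    simp

omit [Fintype ι] in
theorem DegLE.single {d : ι → ℚ} {s : ℚ} {x y : ι} (h : d y - d x ≤ s) :
    DegLE d s (Matrix.single x y (1 : F)) := by
  intro i j hij
  rw [Matrix.single_apply] at hij
  split_ifs at hij with h'
  · rw [← h'.1, ← h'.2]; exact h
  · exact absurd rfl hij

/-- Modulo the slice, every matrix unit is a commutator with `arcMatrix`. -/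
def IsCommutatorModSlice (F : Type*) [Field F] (arc : ι → ι → Prop) (a : ι → ℕ) (d : ι → ℚ)
    (x y : ι) : Prop :=
  ∃ X R : Matrix ι ι F, arcMatrix F arc * X - X * arcMatrix F arc = Matrix.single x y 1 - R ∧
    DegLE d (d y - d x - 1) X ∧ ∀ i j, R i j ≠ 0 → IsSlicePos arc a (i, j)

/-- With x', y' the successors of x, y, one has e_{xy} = [E, e_{x'y}] + e_{x'y'}, the last term
being 0 if y has no successor. Moving both indices forward keeps the degree and the inequality of
depths. It stops when y has no successor, leaving nothing, or when x has none, which is a slice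
position. -/
theorem isCommutatorModSlice_of_le (h : IsPaths arc a) {d : ι → ℚ}
    (hd : ∀ x y, arc x y → d y = d x + 1) {x y : ι} (hxy : a y ≤ a x) :
    IsCommutatorModSlice F arc a d x y := by
  induction hk : (univ.sup a - a x) using Nat.strong_induction_on generalizing x y with
  | _ k ih =>
    by_cases hx : ∃ x', arc x x'
    · obtain ⟨x', hx⟩ := hx
      have e1 := h.depth hx
      have e2 : a x' ≤ univ.sup a := Finset.le_sup (mem_univ x')
      have e3 := hd _ _ hx
      by_cases hy : ∃ y', arc y y'
      · obtain ⟨y', hy⟩ := hy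
        have e4 := hd _ _ hy
        obtain ⟨X, R, h1, h2, h3⟩ := ih _ (by omega) (x := x') (y := y')
          (by have := h.depth hy; omega) rfl
        refine ⟨Matrix.single x' y 1 + X, R, ?_, ?_, h3⟩
        · rw [mul_add, add_mul, arcMatrix_mul_single h hx, single_mul_arcMatrix h hy,
            add_sub_add_comm, h1]
          abel
        · refine (DegLE.single (by linarith)).add (h2.mono (by linarith))
      · push Not at hy
        refine ⟨Matrix.single x' y 1, 0, ?_, DegLE.single (by linarith), by simp⟩
        rw [arcMatrix_mul_single h hx, single_mul_arcMatrix_of_not hy]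
    · push Not at hx
      refine ⟨0, Matrix.single x y 1, by simp, fun i j h => absurd rfl h, ?_⟩
      intro i j hij
      rw [Matrix.single_apply] at hij
      split_ifs at hij with h'
      · rw [← h'.1, ← h'.2]; exact ⟨hx, hxy⟩
      · exact absurd rfl hij

/-- Here the indices move backwards: with x', y' the predecessors, e_{xy} = -[E, e_{xy'}] +
e_{x'y'}. Since y is deeper than x, the start of the path of x is reached first and no slice term
remains. -/
theorem isCommutatorModSlice_of_lt (h : IsPaths arc a) {d : ι → ℚ}
    (hd : ∀ x y, arc x y → d y = d x + 1) {x y : ι} (hxy : a x < a y) :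
    IsCommutatorModSlice F arc a d x y := by
  induction hk : a y generalizing x y with
  | zero => omega
  | succ k ih =>
    obtain ⟨y', hy⟩ := h.pred (show a y ≠ 0 by omega)
    have e1 := h.depth hy
    have e2 := hd _ _ hy
    by_cases hx : ∃ x', arc x' x
    · obtain ⟨x', hx⟩ := hx
      have e3 := h.depth hx
      have e4 := hd _ _ hx
      obtain ⟨X, R, h1, h2, h3⟩ := ih (x := x') (y := y') (by omega) (by omega)
      refine ⟨-Matrix.single x y' 1 + X, R, ?_, ?_, h3⟩
      · rw [mul_add, add_mul, mul_neg, neg_mul, arcMatrix_mul_single h hx,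
          single_mul_arcMatrix h hy, add_sub_add_comm, h1]
        abel
      · exact (DegLE.single (by linarith)).neg.add (h2.mono (by linarith))
    · push Not at hx
      refine ⟨-Matrix.single x y' 1, 0, ?_, (DegLE.single (by linarith)).neg, by simp⟩
      rw [mul_neg, neg_mul, arcMatrix_mul_single_of_not hx, single_mul_arcMatrix h hy]
      simp

theorem isCommutatorModSlice (h : IsPaths arc a) {d : ι → ℚ}
    (hd : ∀ x y, arc x y → d y = d x + 1) (x y : ι) :
    IsCommutatorModSlice F arc a d x y :=
  (le_or_gt (a y) (a x)).elim (isCommutatorModSlice_of_le h hd) (isCommutatorModSlice_of_lt h hd)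

end Commutator

/-! ### Sweeping out positions by conjugation -/

section Average

variable {ι F : Type*} [Fintype ι] [DecidableEq ι] [Field F] [Fintype F]

open Classical in
/-- The affine space of the matrices that agree with `E` outside of the positions in `W`. -/
noncomputable def affineOf (E : Matrix ι ι F) (W : Finset (ι × ι)) : Finset (Matrix ι ι F) :=
  {Y | ∀ i j, (i, j) ∉ W → Y i j = E i j}

omit [Field F] in
theorem mem_affineOf {E : Matrix ι ι F} {W : Finset (ι × ι)} {Y : Matrix ι ι F} :
    Y ∈ affineOf E W ↔ ∀ i j, (i, j) ∉ W → Y i j = E i j := by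
  simp [affineOf]

variable {arc : ι → ι → Prop} {a : ι → ℕ} {d : ι → ℚ}

omit [Fintype ι] [DecidableEq ι] [Fintype F] in
theorem degLE_arcMatrix (hd : ∀ x y, arc x y → d y = d x + 1) :
    DegLE d 1 (arcMatrix F arc) := by
  classical
  intro i j hij
  rw [arcMatrix_apply] at hij
  split_ifs at hij with h
  · rw [hd _ _ h]; linarith
  · exact absurd rfl hij

theorem degLT_sub_of_mem_affineOf {E : Matrix ι ι F} {W : Finset (ι × ι)}
    (hW : ∀ p ∈ W, d p.2 - d p.1 < 1) {Y : Matrix ι ι F} (hY : Y ∈ affineOf E W) :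
    DegLT d 1 (Y - E) := by
  intro i j hij
  by_contra h
  exact hij (by rw [Matrix.sub_apply, mem_affineOf.1 hY i j fun h' => h (hW _ h'), sub_self])

omit [Fintype ι] [DecidableEq ι] [Fintype F] in
theorem degLE_one_of_sub (hd : ∀ x y, arc x y → d y = d x + 1) {Y : Matrix ι ι F}
    (hY : DegLT d 1 (Y - arcMatrix F arc)) : DegLE d 1 Y := by
  have := hY.le.add (degLE_arcMatrix (F := F) hd)
  rwa [sub_add_cancel] at this

omit [Fintype F] in
/-- Conjugation by `1 + c X`, where `X` is of negative degree, changes a matrix of degree at most one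
by `c` times a commutator, up to terms of lower degree. -/
theorem degLT_conj_sub {e : ℚ} (he : e < 1)
    {X Y Z : Matrix ι ι F} {c : F} (hX : DegLE d (e - 1) X) (hY : DegLE d 1 Y) (hZ : DegLE d 1 Z)
    (hYZ : Z * (1 + c • X) = (1 + c • X) * Y)
    (h : DegLT d 1 (Y - arcMatrix F arc) ∨ DegLT d 1 (Z - arcMatrix F arc)) :
    DegLT d e (Z - Y - c • (X * arcMatrix F arc - arcMatrix F arc * X)) := by
  -- This identity is exact, not first order in c. It bounds the degree of Z - Y by e < 1, so
  -- closeness to E passes between Y and Z; then both may be replaced by E at the cost of terms of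
  -- degree less than e.
  have h1 : Z - Y = c • (X * Y - Z * X) := by
    rw [mul_add, add_mul, mul_one, one_mul, Matrix.mul_smul, Matrix.smul_mul] at hYZ
    rw [smul_sub]
    rw [sub_eq_sub_iff_add_eq_add, hYZ, add_comm]
  have h2 : DegLE d e (Z - Y) := by
    rw [h1, sub_eq_add_neg]
    refine DegLE.smul (DegLE.add ?_ (DegLE.neg ?_)) c
    · exact (hX.mul hY).mono (by linarith)
    · exact (hZ.mul hX).mono (by linarith)
  have h3 : DegLT d 1 (Y - arcMatrix F arc) := by
    rcases h with h | h
    · exact h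
    · have := h.add (h2.lt he).neg
      rwa [show Z - arcMatrix F arc + -(Z - Y) = Y - arcMatrix F arc by abel] at this
  have h4 : DegLT d 1 (Z - arcMatrix F arc) := by
    have := h3.add (h2.lt he)
    rwa [show Y - arcMatrix F arc + (Z - Y) = Z - arcMatrix F arc by abel] at this
  have h5 : Z - Y - c • (X * arcMatrix F arc - arcMatrix F arc * X) =
      c • (X * (Y - arcMatrix F arc) + -((Z - arcMatrix F arc) * X)) := by
    rw [h1, ← smul_sub]
    congr 1
    noncomm_ring
  rw [h5]
  refine DegLT.smul (DegLT.add ?_ (DegLT.neg ?_)) c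
  · have := hX.mul_lt h3
    rwa [show e - 1 + 1 = e by ring] at this
  · have := h4.mul_le hX
    rwa [show 1 + (e - 1) = e by ring] at this

/-- Conjugation by g_c adds c at p, up to slice positions and positions of degree below that of p,
all of which lie in W by `hS` and `hmin`. Hence (c, Y) ↦ g_c Y g_c⁻¹ is a bijection from F × (E +
span W) onto E + span (W ∪ {p}) that preserves Ψ. -/
theorem sum_affineOf_insert (h : IsPaths arc a) (hd : ∀ x y, arc x y → d y = d x + 1)
    (Ψ : Matrix ι ι F → ℂ)
    (hΨ : ∀ (g : GL ι F) (Y : Matrix ι ι F), Ψ (g.1 * Y * (g⁻¹ : GL ι F).1) = Ψ Y)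
    {W : Finset (ι × ι)} (hS : ∀ p, IsSlicePos arc a p → p ∈ W)
    (hW : ∀ p ∈ W, d p.2 - d p.1 < 1) {p : ι × ι} (hp : p ∉ W) (hp1 : d p.2 - d p.1 < 1)
    (hmin : ∀ q : ι × ι, d q.2 - d q.1 < d p.2 - d p.1 → q ∈ W) :
    ∑ Y ∈ affineOf (arcMatrix F arc) (insert p W), Ψ Y =
      Fintype.card F * ∑ Y ∈ affineOf (arcMatrix F arc) W, Ψ Y := by
  classical
  obtain ⟨x, y⟩ := p
  obtain ⟨X, R, hXR, hXdeg, hR⟩ := isCommutatorModSlice (F := F) h hd x y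
  simp only at hp1 hmin
  set e := d y - d x with he
  set E := arcMatrix F arc with hE
  have hneg : e - 1 < 0 := by linarith
  have hXn : ∀ c : F, DegLE d (e - 1) (c • -X) := fun c => hXdeg.neg.smul c
  -- The sign is needed because conjugation by 1 + cX adds c(XE - EX), while `hXR` concerns EX - XE.
  let g : F → GL ι F := fun c =>
    Matrix.GeneralLinearGroup.mkOfDetNeZero (1 + c • -X) (det_one_add_ne_zero hneg (hXn c))
  have hg : ∀ c, (g c : Matrix ι ι F) = 1 + c • -X := fun c => rfl
  have hg0 : ∀ c, DegLE d 0 (g c : Matrix ι ι F) := fun c => by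
    rw [hg]; exact DegLE.one.add ((hXn c).mono hneg.le)
  have hginv : ∀ c, DegLE d 0 ((g c)⁻¹ : GL ι F).1 := fun c => DegLE.inv _ (hg0 c)
  have hExy : E x y = 0 := by
    rw [hE, arcMatrix_apply, if_neg]
    intro h'
    have := hd _ _ h'
    linarith
  have hW' : ∀ q ∈ insert (x, y) W, d q.2 - d q.1 < 1 := by
    intro q hq
    rcases Finset.mem_insert.1 hq with rfl | hq
    · exact hp1
    · exact hW q hq
  have key : ∀ (c : F) (Y Z : Matrix ι ι F), DegLE d 1 Y → DegLE d 1 Z →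
      Z * (g c).1 = (g c).1 * Y → (DegLT d 1 (Y - E) ∨ DegLT d 1 (Z - E)) →
      ∀ i j, (i, j) ∉ W → Z i j = Y i j + if (i, j) = (x, y) then c else 0 := by
    intro c Y Z hY hZ hYZ hor i j hij
    have h1 := degLT_conj_sub hp1 hXdeg.neg hY hZ hYZ hor
    have h2 : (Z - Y - c • (-X * E - E * -X)) i j = 0 := by
      by_contra h'
      exact hij (hmin (i, j) (h1 i j h'))
    have h3 : -X * E - E * -X = Matrix.single x y 1 - R := by
      rw [← hXR]; noncomm_ring
    have h4 : R i j = 0 := by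
      by_contra h'
      exact hij (hS _ (hR i j h'))
    rw [h3, Matrix.sub_apply, Matrix.sub_apply, Matrix.smul_apply, Matrix.sub_apply, h4, sub_zero,
      Matrix.single_apply] at h2
    have h5 : ((i, j) = (x, y)) ↔ (x = i ∧ y = j) := by
      rw [Prod.mk.injEq]; tauto
    simp only [h5]
    split_ifs at h2 ⊢
    · rw [smul_eq_mul] at h2; linear_combination h2
    · rw [smul_zero] at h2; linear_combination h2
  have hfwd : ∀ c, ∀ Y ∈ affineOf E W,
      (g c).1 * Y * ((g c)⁻¹ : GL ι F).1 ∈ affineOf E (insert (x, y) W) ∧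
      ((g c).1 * Y * ((g c)⁻¹ : GL ι F).1) x y = c := by
    intro c Y hY
    have hY1 := degLT_sub_of_mem_affineOf hW hY
    have hY2 := degLE_one_of_sub hd hY1
    have hk := key c Y ((g c).1 * Y * ((g c)⁻¹ : GL ι F).1) hY2
      ((((hg0 c).mul hY2).mul (hginv c)).mono (by linarith))
      (by rw [mul_assoc, ← Units.val_mul, inv_mul_cancel, Units.val_one, mul_one]) (Or.inl hY1)
    have hY3 := mem_affineOf.1 hY
    refine ⟨mem_affineOf.2 fun i j hij => ?_, ?_⟩
    · rw [Finset.mem_insert, not_or] at hij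
      rw [hk i j hij.2, if_neg hij.1, add_zero, hY3 i j hij.2]
    · rw [hk x y hp, if_pos rfl, hY3 x y hp, hExy, zero_add]
  -- E vanishes at (x, y), so the parameter c can be read off as the entry `Z x y`; this provides
  -- the inverse map.
  have hbwd : ∀ Z ∈ affineOf E (insert (x, y) W),
      ((g (Z x y))⁻¹ : GL ι F).1 * Z * (g (Z x y)).1 ∈ affineOf E W := by
    intro Z hZ
    set c := Z x y with hc
    have hZ1 := degLT_sub_of_mem_affineOf hW' hZ
    have hZ2 := degLE_one_of_sub hd hZ1
    have hk := key c (((g c)⁻¹ : GL ι F).1 * Z * (g c).1) Z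
      ((((hginv c).mul hZ2).mul (hg0 c)).mono (by linarith)) hZ2
      (by rw [mul_assoc, ← mul_assoc (g c).1, ← Units.val_mul, mul_inv_cancel, Units.val_one,
        one_mul]) (Or.inr hZ1)
    have hZ3 := mem_affineOf.1 hZ
    refine mem_affineOf.2 fun i j hij => ?_
    have := hk i j hij
    split_ifs at this with h'
    · obtain ⟨rfl, rfl⟩ := Prod.mk.inj h'
      rw [hExy]
      rw [← hc] at this
      linear_combination -this
    · rw [add_zero] at this
      rw [← this]
      refine hZ3 i j ?_
      rw [Finset.mem_insert, not_or]
      exact ⟨h', hij⟩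
  have hsum : ∑ q ∈ (univ : Finset F) ×ˢ affineOf E W, Ψ q.2 =
      ∑ Y ∈ affineOf E (insert (x, y) W), Ψ Y := by
    refine Finset.sum_bij' (fun q _ => (g q.1).1 * q.2 * ((g q.1)⁻¹ : GL ι F).1)
      (fun Z _ => (Z x y, ((g (Z x y))⁻¹ : GL ι F).1 * Z * (g (Z x y)).1)) ?_ ?_ ?_ ?_ ?_
    · rintro ⟨c, Y⟩ hq
      exact (hfwd c Y (Finset.mem_product.1 hq).2).1
    · intro Z hZ
      exact Finset.mem_product.2 ⟨Finset.mem_univ _, hbwd Z hZ⟩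
    · rintro ⟨c, Y⟩ hq
      have e1 := (hfwd c Y (Finset.mem_product.1 hq).2).2
      simp only [e1]
      congr 1
      rw [mul_assoc, mul_assoc, mul_assoc, ← Units.val_mul, inv_mul_cancel, Units.val_one, mul_one,
        ← mul_assoc, ← Units.val_mul, inv_mul_cancel, Units.val_one, one_mul]
    · intro Z hZ
      simp only
      rw [mul_assoc, mul_assoc, mul_assoc, ← Units.val_mul, mul_inv_cancel, Units.val_one, mul_one,
        ← mul_assoc, ← Units.val_mul, mul_inv_cancel, Units.val_one, one_mul]
    · rintro ⟨c, Y⟩ hq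
      exact (hΨ (g c) Y).symm
  rw [← hsum, Finset.sum_product]
  simp

open Classical in
/-- The average of a class function over `E + span W` is the average over the slice. -/
theorem sum_affineOf_mul (h : IsPaths arc a) (hd : ∀ x y, arc x y → d y = d x + 1)
    (Ψ : Matrix ι ι F → ℂ)
    (hΨ : ∀ (g : GL ι F) (Y : Matrix ι ι F), Ψ (g.1 * Y * (g⁻¹ : GL ι F).1) = Ψ Y)
    {W : Finset (ι × ι)} (hS : ∀ p, IsSlicePos arc a p → p ∈ W)
    (hW : ∀ p ∈ W, d p.2 - d p.1 < 1) :
    (∑ Y ∈ affineOf (arcMatrix F arc) W, Ψ Y) *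
        (Fintype.card F : ℂ) ^ #{p : ι × ι | IsSlicePos arc a p} =
      (∑ Y ∈ affineOf (arcMatrix F arc) {p : ι × ι | IsSlicePos arc a p}, Ψ Y) *
        (Fintype.card F : ℂ) ^ #W := by
  -- T is the largest admissible set. W and the slice are each enlarged to T; taking a missing
  -- position of least degree ensures that all positions of lower degree are already present.
  set T : Finset (ι × ι) := {p | d p.2 - d p.1 < 1} with hT
  have hmT : ∀ p, p ∈ T ↔ d p.2 - d p.1 < 1 := fun p => by simp [hT]
  have key : ∀ V : Finset (ι × ι), (∀ p, IsSlicePos arc a p → p ∈ V) →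
      (∀ p ∈ V, d p.2 - d p.1 < 1) →
      (∑ Y ∈ affineOf (arcMatrix F arc) V, Ψ Y) * (Fintype.card F : ℂ) ^ #T =
      (∑ Y ∈ affineOf (arcMatrix F arc) T, Ψ Y) * (Fintype.card F : ℂ) ^ #V := by
    intro V hSV hV
    induction hk : #(T \ V) generalizing V with
    | zero =>
      have : V = T := by
        refine Finset.Subset.antisymm (fun p hp => (hmT p).2 (hV p hp)) ?_
        rwa [Finset.card_eq_zero, Finset.sdiff_eq_empty_iff_subset] at hk
      rw [this]
    | succ k ih =>
      obtain ⟨p, hp, hmin⟩ := Finset.exists_min_image (T \ V) (fun p => d p.2 - d p.1)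
        (Finset.card_pos.1 (by omega))
      rw [Finset.mem_sdiff, hmT] at hp
      have hstep := sum_affineOf_insert h hd Ψ hΨ hSV hV hp.2 hp.1 (by
        intro q hq
        by_contra hqV
        have := hmin q (Finset.mem_sdiff.2 ⟨(hmT q).2 (by linarith), hqV⟩)
        linarith)
      have := ih (insert p V) (fun q hq => Finset.mem_insert_of_mem (hSV q hq)) (by
        intro q hq
        rcases Finset.mem_insert.1 hq with rfl | hq
        · exact hp.1
        · exact hV q hq) (by
        rw [Finset.sdiff_insert, Finset.card_erase_of_mem (Finset.mem_sdiff.2 ⟨(hmT p).2 hp.1, hp.2⟩)]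
        omega)
      rw [hstep, Finset.card_insert_of_notMem hp.2, pow_succ] at this
      have hq : (Fintype.card F : ℂ) ≠ 0 := Nat.cast_ne_zero.2 Fintype.card_ne_zero
      apply mul_left_cancel₀ hq
      linear_combination this
  have hq : (Fintype.card F : ℂ) ^ #T ≠ 0 :=
    pow_ne_zero _ (Nat.cast_ne_zero.2 Fintype.card_ne_zero)
  have h1 := key W hS hW
  have h2 := key {p | IsSlicePos arc a p} (by simp) (fun p hp => hW p (hS p (by simpa using hp)))
  apply mul_right_cancel₀ hq
  linear_combination (Fintype.card F : ℂ) ^ #{p : ι × ι | IsSlicePos arc a p} * h1 -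
    (Fintype.card F : ℂ) ^ #W * h2

end Average

/-! ### Fourier inversion and the class function on matrices -/

section Fourier

variable {ι F : Type*} [Fintype ι] [DecidableEq ι] [Field F] [Fintype F]

omit [Fintype F] in
theorem apply_submatrix_of_conj {Ψ : Matrix ι ι F → ℂ}
    (hΨ : ∀ (g : GL ι F) (Y : Matrix ι ι F), Ψ (g.1 * Y * (g⁻¹ : GL ι F).1) = Ψ Y)
    (π : Equiv.Perm ι) (Y : Matrix ι ι F) : Ψ (Y.submatrix π π) = Ψ Y := by
  let g : GL ι F := ⟨π.toPEquiv.toMatrix, π.symm.toPEquiv.toMatrix, by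
    rw [← PEquiv.toMatrix_trans, ← Equiv.toPEquiv_trans]; simp, by
    rw [← PEquiv.toMatrix_trans, ← Equiv.toPEquiv_trans]; simp⟩
  rw [← hΨ g Y]
  congr 1
  change _ = π.toPEquiv.toMatrix * Y * π.symm.toPEquiv.toMatrix
  rw [PEquiv.toMatrix_toPEquiv_mul, PEquiv.mul_toMatrix_toPEquiv]
  rfl

theorem sum_affineOf_perm {Ψ : Matrix ι ι F → ℂ}
    (hΨ : ∀ (g : GL ι F) (Y : Matrix ι ι F), Ψ (g.1 * Y * (g⁻¹ : GL ι F).1) = Ψ Y)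
    (π : Equiv.Perm ι) {E E' : Matrix ι ι F} {W W' : Finset (ι × ι)}
    (hE : ∀ x y, E' (π x) (π y) = E x y) (hW : ∀ x y, (π x, π y) ∈ W' ↔ (x, y) ∈ W) :
    ∑ Y ∈ affineOf E' W', Ψ Y = ∑ Y ∈ affineOf E W, Ψ Y := by
  refine Finset.sum_bij' (fun Y _ => Y.submatrix π π) (fun Y _ => Y.submatrix π.symm π.symm)
    ?_ ?_ ?_ ?_ ?_
  · intro Y hY
    rw [mem_affineOf] at hY ⊢
    intro i j hij
    rw [Matrix.submatrix_apply, ← hE, hY]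
    rwa [hW]
  · intro Y hY
    rw [mem_affineOf] at hY ⊢
    intro i j hij
    rw [Matrix.submatrix_apply, hY, ← hE, Equiv.apply_symm_apply, Equiv.apply_symm_apply]
    rwa [← hW, Equiv.apply_symm_apply, Equiv.apply_symm_apply]
  · intro Y _
    ext i j
    simp
  · intro Y _
    ext i j
    simp
  · intro Y _
    exact (apply_submatrix_of_conj hΨ π Y).symm

theorem map_sum_eq_prod {A R κ : Type*} [AddCommMonoid A] [CommMonoid R]
    (ψ : AddChar A R) (s : Finset κ) (f : κ → A) : ψ (∑ i ∈ s, f i) = ∏ i ∈ s, ψ (f i) := by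
  classical
  induction s using Finset.induction_on with
  | empty => simp
  | insert i s hi ih => rw [sum_insert hi, prod_insert hi, AddChar.map_add_eq_mul, ih]

-- The sum factors over the positions. A free position contributes a full character sum, which is q
-- or 0 as `M` vanishes there or not, because a nontrivial `ϑ` is primitive; a fixed position
-- contributes one value.
open Classical in
theorem sum_affineOf_addChar {ϑ : AddChar F ℂ} (hϑ : ϑ ≠ 1) (E : Matrix ι ι F)
    (W : Finset (ι × ι)) (M : Matrix ι ι F) :
    ∑ Y ∈ affineOf E W, ϑ (∑ p : ι × ι, Y p.1 p.2 * M p.1 p.2) =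
      if ∀ p ∈ W, M p.1 p.2 = 0 then
        (Fintype.card F : ℂ) ^ #W * ∏ p ∈ Wᶜ, ϑ (E p.1 p.2 * M p.1 p.2) else 0 := by
  have h1 : ∑ Y ∈ affineOf E W, ϑ (∑ p : ι × ι, Y p.1 p.2 * M p.1 p.2) =
      ∑ f ∈ Fintype.piFinset (fun p : ι × ι => if p ∈ W then univ else {E p.1 p.2}),
        ∏ p : ι × ι, ϑ (f p * M p.1 p.2) := by
    refine Finset.sum_bij' (fun Y _ p => Y p.1 p.2) (fun f _ => Matrix.of fun i j => f (i, j))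
      ?_ ?_ ?_ ?_ ?_
    · intro Y hY
      rw [Fintype.mem_piFinset]
      rintro ⟨i, j⟩
      split_ifs with h
      · exact mem_univ _
      · exact mem_singleton.2 (mem_affineOf.1 hY i j h)
    · intro f hf
      rw [Fintype.mem_piFinset] at hf
      rw [mem_affineOf]
      intro i j h
      have := hf (i, j)
      rw [if_neg h] at this
      exact mem_singleton.1 this
    · intro Y _; rfl
    · intro f _; rfl
    · intro Y _
      exact map_sum_eq_prod ϑ _ _
  rw [h1, ← Finset.prod_univ_sum (fun p : ι × ι => if p ∈ W then univ else {E p.1 p.2})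
    (fun p c => ϑ (c * M p.1 p.2)), ← Finset.prod_mul_prod_compl W]
  have h2 : ∀ p ∈ Wᶜ, ∑ c ∈ (if p ∈ W then univ else {E p.1 p.2}), ϑ (c * M p.1 p.2) =
      ϑ (E p.1 p.2 * M p.1 p.2) := by
    intro p hp
    rw [if_neg (Finset.mem_compl.1 hp), Finset.sum_singleton]
  have h3 : ∀ p ∈ W, ∑ c ∈ (if p ∈ W then univ else {E p.1 p.2}), ϑ (c * M p.1 p.2) =
      if M p.1 p.2 = 0 then (Fintype.card F : ℂ) else 0 := by
    intro p hp
    rw [if_pos hp, AddChar.sum_mulShift _ (AddChar.IsPrimitive.of_ne_one hϑ)]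
    split_ifs <;> simp
  rw [Finset.prod_congr rfl h2, Finset.prod_congr rfl h3]
  split_ifs with h
  · rw [Finset.prod_congr rfl fun p hp => if_pos (h p hp), Finset.prod_const]
  · push Not at h
    obtain ⟨p, hp, hM⟩ := h
    rw [Finset.prod_eq_zero hp (if_neg hM), zero_mul]

omit [DecidableEq ι] [Fintype F] in
theorem sum_mul_eq_trace (Y M : Matrix ι ι F) :
    ∑ p : ι × ι, Y p.1 p.2 * M p.1 p.2 = (Y.transpose * M).trace := by
  rw [Fintype.sum_prod_type, Finset.sum_comm, Matrix.trace]
  simp [Matrix.mul_apply]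

/-- The sum of the additive character `ϑ` of the pairings of `Y` with the conjugates of `g - 1`. -/
noncomputable def orbitSum (ϑ : AddChar F ℂ) [Fintype (GL ι F)] (g : GL ι F) (Y : Matrix ι ι F) : ℂ :=
  ∑ x : GL ι F, ϑ (∑ p : ι × ι, Y p.1 p.2 * ((x * g * x⁻¹ : GL ι F).1 - 1) p.1 p.2)

-- The pairing is tr(YᵀM), so conjugating Y by h amounts to conjugating M by hᵀ, which is absorbed
-- by the substitution x ↦ hᵀx.
omit [Fintype F] in
theorem orbitSum_conj (ϑ : AddChar F ℂ) [Fintype (GL ι F)] (g h : GL ι F) (Y : Matrix ι ι F) :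
    orbitSum ϑ g (h.1 * Y * (h⁻¹ : GL ι F).1) = orbitSum ϑ g Y := by
  let k : GL ι F := ⟨h.1.transpose, (h⁻¹ : GL ι F).1.transpose, by
    rw [← Matrix.transpose_mul, ← Units.val_mul, inv_mul_cancel]; simp, by
    rw [← Matrix.transpose_mul, ← Units.val_mul, mul_inv_cancel]; simp⟩
  have hk : k.1 = h.1.transpose := rfl
  have hk' : (k⁻¹ : GL ι F).1 = (h⁻¹ : GL ι F).1.transpose := rfl
  refine Fintype.sum_equiv (Equiv.mulLeft k) _ _ fun x => ?_
  congr 1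
  rw [sum_mul_eq_trace, sum_mul_eq_trace, Matrix.transpose_mul, Matrix.transpose_mul, ← hk, ← hk',
    mul_assoc, Matrix.trace_mul_comm, mul_assoc, mul_assoc]
  congr 2
  have : k.1 * (k⁻¹ : GL ι F).1 = 1 := by rw [← Units.val_mul, mul_inv_cancel, Units.val_one]
  simp only [Equiv.coe_mulLeft, mul_inv_rev, Units.val_mul, mul_sub, sub_mul, mul_assoc]
  rw [one_mul, this]

end Fourier

/-- The relation of being joined by an arc. -/
def SetPartition.Arc {n : ℕ} (η : SetPartition n) (i j : Fin n) : Prop := (i, j) ∈ η.arcs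

open Classical in
/-- The sum of `γ_η` over the conjugates of `g` lying in a pattern group. -/
theorem sum_conj_eq_sum_affineOf {F : Type*} [Field F] [Fintype F] {n : ℕ} {ϑ : AddChar F ℂ}
    (hϑ : ϑ ≠ 1) [Fintype (GL (Fin n) F)] (η : SetPartition n) (W : Finset (Fin n × Fin n))
    (hW : ∀ p ∈ η.arcs, p ∉ W) (g : GL (Fin n) F) :
    (Fintype.card F : ℂ) ^ #W * ∑ x : GL (Fin n) F,
        (if ∀ p ∈ W, ((x * g * x⁻¹ : GL (Fin n) F).1 - 1) p.1 p.2 = 0 then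
          η.γ ϑ (x * g * x⁻¹) else 0) =
      ∑ Y ∈ affineOf (arcMatrix F η.Arc) W, orbitSum ϑ g Y := by
  rw [Finset.mul_sum]
  simp only [orbitSum]
  rw [Finset.sum_comm]
  refine Finset.sum_congr rfl fun x _ => ?_
  rw [sum_affineOf_addChar hϑ, mul_ite, mul_zero]
  congr 2
  -- Off W only the arcs contribute, since E is 0 elsewhere; subtracting the identity does not
  -- affect the arcs, which are off the diagonal.
  rw [SetPartition.γ, ← Finset.prod_subset (s₁ := η.arcs) (s₂ := Wᶜ)]
  · refine Finset.prod_congr rfl fun p hp => ?_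
    rw [arcMatrix_apply, if_pos (show η.Arc p.1 p.2 from hp), one_mul, Matrix.sub_apply, Matrix.one_apply_ne (η.lt p hp).ne,
      sub_zero]
  · exact fun p hp => Finset.mem_compl.2 (hW p hp)
  · intro p _ hp
    rw [arcMatrix_apply, if_neg (show ¬ η.Arc p.1 p.2 from hp), zero_mul, AddChar.map_zero_eq_one]

/-! ### Normal pattern subgroups -/

section Pattern

variable {F : Type*} [Field F] {n : ℕ}

/-- The element `1 + c e_{ij}` of a root subgroup. -/
def root {i j : Fin n} (h : i ≠ j) (c : F) : GL (Fin n) F where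
  val := Matrix.transvection i j c
  inv := Matrix.transvection i j (-c)
  val_inv := by rw [Matrix.transvection_mul_transvection_same i j h]; simp
  inv_val := by rw [Matrix.transvection_mul_transvection_same i j h]; simp

theorem root_apply {i j : Fin n} (h : i ≠ j) (c : F) (k l : Fin n) :
    (root h c).1 k l = (1 : Matrix (Fin n) (Fin n) F) k l + if k = i ∧ l = j then c else 0 := by
  change Matrix.transvection i j c k l = _
  rw [Matrix.transvection, Matrix.add_apply, Matrix.single_apply]
  simp only [eq_comm]

theorem commutator_root {i j k : Fin n} (hij : i ≠ j) (hjk : j ≠ k) (hik : i ≠ k) (a b : F) :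
    ⁅root hij a, root hjk b⁆ = root hik (a * b) := by
  have h : root hij a * root hjk b = root hik (a * b) * (root hjk b * root hij a) := by
    apply Units.ext
    change (1 + Matrix.single i j a) * (1 + Matrix.single j k b) =
      (1 + Matrix.single i k (a * b)) * ((1 + Matrix.single j k b) * (1 + Matrix.single i j a))
    simp only [mul_add, add_mul, mul_one, one_mul, Matrix.single_mul_single_same,
      Matrix.single_mul_single_of_ne _ _ _ _ hik.symm, Matrix.single_mul_single_of_ne _ _ _ _ hjk.symm,
      add_zero]
    abel
  rw [commutatorElement_def, h]
  group

/-- The diagonal matrix with given invertible entries. -/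
def diagUnit (t : Fin n → Fˣ) : GL (Fin n) F where
  val := Matrix.diagonal fun i => (t i : F)
  inv := Matrix.diagonal fun i => ((t i)⁻¹ : Fˣ)
  val_inv := by simp
  inv_val := by simp

variable [Finite F]

theorem apply_of_mem_UT {g : GL (Fin n) F} (hg : g ∈ UT n F) {i j : Fin n} (hij : j ≤ i) :
    g.1 i j = (1 : Matrix (Fin n) (Fin n) F) i j := by
  by_contra h
  exact absurd (mem_unipotentOf.1 hg i j (by rwa [Matrix.sub_apply, sub_ne_zero])) (not_lt.2 hij)

theorem root_mem_UT {i j : Fin n} (h : i < j) (c : F) : root h.ne c ∈ UT n F := by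
  refine mem_unipotentOf.2 fun k l hkl => ?_
  rw [Matrix.sub_apply, root_apply, add_sub_cancel_left] at hkl
  split_ifs at hkl with h'
  · rw [h'.1, h'.2]; exact h
  · exact absurd rfl hkl

/-- Clear the entries one at a time, lowest row first. If (i, j) lies in the lowest row with a
nonzero entry above the diagonal, row j is that of the identity, so left multiplication by 1 -
g_{ij} e_{ij} changes this single entry. -/
theorem mem_of_root_mem {U : Subgroup (GL (Fin n) F)} {g : GL (Fin n) F} (hg : g ∈ UT n F)
    (h : ∀ (i j : Fin n) (hij : i < j), g.1 i j ≠ 0 → ∀ c : F, root hij.ne c ∈ U) : g ∈ U := by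
  classical
  induction hk : #{p : Fin n × Fin n | p.1 < p.2 ∧ g.1 p.1 p.2 ≠ 0} using
    Nat.strong_induction_on generalizing g with
  | _ k ih =>
    rcases Finset.eq_empty_or_nonempty {p : Fin n × Fin n | p.1 < p.2 ∧ g.1 p.1 p.2 ≠ 0}
      with h0 | h0
    · have : g = 1 := by
        apply Units.ext
        ext i j
        rcases le_or_gt j i with hij | hij
        · exact apply_of_mem_UT hg hij
        · rw [Units.val_one, Matrix.one_apply_ne hij.ne]
          by_contra hne
          exact (Finset.eq_empty_iff_forall_notMem.1 h0 (i, j)) (by simp [hij, hne])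
      rw [this]; exact U.one_mem
    · obtain ⟨⟨i, j⟩, hp, hmax⟩ := Finset.exists_max_image _ (fun p => p.1) h0
      simp only [mem_filter, mem_univ, true_and] at hp hmax
      obtain ⟨hij, hne⟩ := hp
      have hrow : ∀ l, g.1 j l = (1 : Matrix (Fin n) (Fin n) F) j l := by
        intro l
        rcases le_or_gt l j with hl | hl
        · exact apply_of_mem_UT hg hl
        · rw [Matrix.one_apply_ne hl.ne]
          by_contra hne
          exact absurd (hmax (j, l) ⟨hl, hne⟩) (not_le.2 hij)
      have happ : ∀ k l, (root hij.ne (-g.1 i j) * g).1 k l =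
          if k = i ∧ l = j then 0 else g.1 k l := by
        intro k l
        have : (root hij.ne (-g.1 i j) * g).1 = g.1 + Matrix.single i j (-g.1 i j) * g.1 := by
          change (1 + Matrix.single i j (-g.1 i j)) * g.1 = _
          rw [add_mul, one_mul]
        rw [this, Matrix.add_apply]
        by_cases hk : k = i
        · subst hk
          rw [Matrix.single_mul_apply_same, hrow, Matrix.one_apply]
          by_cases hl : l = j
          · subst hl; simp
          · simp [hl, Ne.symm hl]
        · rw [Matrix.single_mul_apply_of_ne _ _ _ _ _ hk]
          simp [hk]
      have hmem : root hij.ne (-g.1 i j) * g ∈ U := by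
        refine ih _ ?_ (mul_mem (root_mem_UT hij _) hg) ?_ rfl
        · rw [← hk]
          refine Finset.card_lt_card ((Finset.ssubset_iff_of_subset ?_).2 ⟨(i, j), ?_, ?_⟩)
          · rintro ⟨k, l⟩ hkl
            simp only [mem_filter, mem_univ, true_and, happ] at hkl ⊢
            exact ⟨hkl.1, fun h' => hkl.2 (by simp [h'])⟩
          · simp [hij, hne]
          · simp [happ]
        · intro k l hkl hne'
          rw [happ] at hne'
          exact h k l hkl fun h' => hne' (by simp [h'])
      exact (Subgroup.mul_mem_cancel_left U (h i j hij hne _)).1 hmem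

omit [Finite F] in
theorem exists_scaled {U : Subgroup (GL (Fin n) F)}
    (hU : ∀ t : GL (Fin n) F, (t : Matrix (Fin n) (Fin n) F).IsDiag →
      t ∈ Subgroup.normalizer (U : Set (GL (Fin n) F))) {u : GL (Fin n) F} (hu : u ∈ U)
    (t : Fin n → Fˣ) : ∃ v ∈ U, ∀ k l, v.1 k l = t k * u.1 k l * ((t l)⁻¹ : Fˣ) := by
  refine ⟨diagUnit t * u * (diagUnit t)⁻¹, ?_, ?_⟩
  · exact (Subgroup.mem_normalizer_iff.1 (hU (diagUnit t) (Matrix.isDiag_diagonal _)) u).1 hu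
  · intro k l
    change (Matrix.diagonal (fun i => (t i : F)) * u.1 *
      Matrix.diagonal fun i => (((t i)⁻¹ : Fˣ) : F)) k l = _
    rw [Matrix.mul_diagonal, Matrix.diagonal_mul]

omit [Finite F] in
/-- If two elements of `U` differ by a column vector `b` in the column `j`, and the row `j` of one of
them is that of the identity matrix, then the identity matrix modified by `b` lies in `U`. -/
theorem exists_mem_column {U : Subgroup (GL (Fin n) F)} {y y' : GL (Fin n) F} (hy : y ∈ U)
    (hy' : y' ∈ U) {j : Fin n} (hrow : ∀ l, y.1 j l = (1 : Matrix (Fin n) (Fin n) F) j l)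
    (b : Fin n → F) (hb : ∀ k l, y'.1 k l = y.1 k l + if l = j then b k else 0) :
    ∃ z ∈ U, ∀ k l, z.1 k l = (1 : Matrix (Fin n) (Fin n) F) k l + if l = j then b k else 0 := by
  refine ⟨y' * y⁻¹, mul_mem hy' (inv_mem hy), fun k l => ?_⟩
  have hinv : y.1 * (y⁻¹ : GL (Fin n) F).1 = 1 := by
    rw [← Units.val_mul, mul_inv_cancel, Units.val_one]
  have hrow' : (y⁻¹ : GL (Fin n) F).1 j l = (1 : Matrix (Fin n) (Fin n) F) j l := by
    rw [← hinv, Matrix.mul_apply]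
    simp [hrow, Matrix.one_apply]
  rw [← hinv, Units.val_mul, Matrix.mul_apply, Matrix.mul_apply]
  simp only [hb, add_mul, Finset.sum_add_distrib, ite_mul, zero_mul, Finset.sum_ite_eq',
    Finset.mem_univ, if_true]
  rw [hrow', Matrix.one_apply]
  simp [eq_comm]

/-- Three quotients by diagonal conjugates isolate the position (i, j). Scaling at i in u⁻¹ and
multiplying by u makes row j trivial and keeps entry (i, j) nonzero; scaling at j then leaves only
column j; scaling at i again leaves only (i, j). A last conjugation turns the nonzero entry into any
prescribed nonzero c. -/
theorem root_mem_of_torus {U : Subgroup (GL (Fin n) F)} (hUT : U ≤ UT n F)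
    (hU : ∀ t : GL (Fin n) F, (t : Matrix (Fin n) (Fin n) F).IsDiag →
      t ∈ Subgroup.normalizer (U : Set (GL (Fin n) F))) {s : Fˣ} (hs : s ≠ 1)
    {u : GL (Fin n) F} (hu : u ∈ U) {i j : Fin n} (hij : i < j) (hne : u.1 i j ≠ 0) (c : F) :
    root hij.ne c ∈ U := by
  classical
  have hs1 : (s : F) - 1 ≠ 0 := sub_ne_zero.2 fun h => hs (Units.ext h)
  have hs2 : ((s⁻¹ : Fˣ) : F) - 1 ≠ 0 :=
    sub_ne_zero.2 fun h => hs (inv_eq_one.1 (Units.ext h))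
  have one_ij : (1 : Matrix (Fin n) (Fin n) F) i j = 0 := Matrix.one_apply_ne hij.ne
  obtain ⟨y, hy, hyrow, hyij⟩ : ∃ y ∈ U,
      (∀ l, y.1 j l = (1 : Matrix (Fin n) (Fin n) F) j l) ∧ y.1 i j ≠ 0 := by
    obtain ⟨v, hv, hv'⟩ := exists_scaled hU (inv_mem hu) (fun k => if k = i then s else 1)
    have hw := hUT (inv_mem hu)
    set w : GL (Fin n) F := u⁻¹ with hwdef
    have hinv : w.1 * u.1 = 1 := by
      rw [← Units.val_mul, hwdef, inv_mul_cancel, Units.val_one]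
    refine ⟨v * u, mul_mem hv hu, ?_, ?_⟩
    · intro l
      rw [← hinv, Units.val_mul, Matrix.mul_apply, Matrix.mul_apply]
      refine Finset.sum_congr rfl fun m _ => ?_
      rw [hv', if_neg hij.ne']
      by_cases hm : m = i
      · rw [hm, apply_of_mem_UT hw hij.le, Matrix.one_apply_ne hij.ne']
        simp
      · simp [hm]
    · have : (v * u).1 i j = s * (w.1 * u.1) i j + (1 - s) * u.1 i j := by
        rw [Units.val_mul, Matrix.mul_apply, Matrix.mul_apply, Finset.mul_sum,
          ← Finset.add_sum_erase _ _ (Finset.mem_univ i),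
          ← Finset.add_sum_erase (a := i) _ (fun m => (s : F) * _) (Finset.mem_univ i),
          Finset.sum_congr rfl (g := fun m => (s : F) * (w.1 i m * u.1 m j))]
        · rw [hv', apply_of_mem_UT hw le_rfl]
          simp
          ring
        · intro m hm
          rw [hv', if_pos rfl, if_neg (Finset.ne_of_mem_erase hm)]
          simp
          ring
      rw [this, hinv, one_ij, mul_zero, zero_add]
      exact mul_ne_zero (fun h => hs1 (by linear_combination -h)) hne
  obtain ⟨z, hz, b, hbi, hbj, hzb⟩ : ∃ z ∈ U, ∃ b : Fin n → F, b i ≠ 0 ∧ b j = 0 ∧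
      ∀ k l, z.1 k l = (1 : Matrix (Fin n) (Fin n) F) k l + if l = j then b k else 0 := by
    obtain ⟨y', hy', hyy'⟩ := exists_scaled hU hy (fun k => if k = j then s else 1)
    obtain ⟨z, hz, hz'⟩ := exists_mem_column hy hy' hyrow
      (fun k => if k = j then 0 else (((s⁻¹ : Fˣ) : F) - 1) * y.1 k j) (by
        intro k l
        rw [hyy']
        by_cases hk : k = j
        · subst hk
          rw [hyrow]
          by_cases hl : l = k
          · subst hl; simp
          · simp [Matrix.one_apply_ne (Ne.symm hl)]
        · by_cases hl : l = j
          · subst hl; simp [hk]; ring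
          · simp [hk, hl])
    exact ⟨z, hz, _, by simpa only [if_neg hij.ne] using mul_ne_zero hs2 hyij,
      by simp, hz'⟩
  obtain ⟨r, hr, hr'⟩ : ∃ r ∈ U, ∀ k l, r.1 k l = (1 : Matrix (Fin n) (Fin n) F) k l +
      if k = i ∧ l = j then ((s : F) - 1) * b i else 0 := by
    obtain ⟨z', hz', hzz'⟩ := exists_scaled hU hz (fun k => if k = i then s else 1)
    obtain ⟨r, hr, hr'⟩ := exists_mem_column hz hz' (j := j)
      (fun l => by rw [hzb, hbj]; simp)
      (fun k => if k = i then ((s : F) - 1) * b i else 0) (by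
        intro k l
        rw [hzz', hzb]
        by_cases hl : l = j
        · subst hl
          by_cases hk : k = i
          · subst hk
            simp [one_ij, hij.ne']
            ring
          · simp [hk, hij.ne']
        · by_cases hk : k = l
          · subst hk
            simp [hl]
          · simp [Matrix.one_apply_ne hk, hl])
    refine ⟨r, hr, fun k l => ?_⟩
    rw [hr']
    by_cases hl : l = j <;> by_cases hk : k = i <;> simp [hl, hk]
  have hc0 : ((s : F) - 1) * b i ≠ 0 := mul_ne_zero hs1 hbi
  set c0 := ((s : F) - 1) * b i with hc0def
  by_cases hc : c = 0
  · subst hc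
    have : root hij.ne (0 : F) = 1 := Units.ext (Matrix.transvection_zero i j)
    rw [this]; exact U.one_mem
  · obtain ⟨v, hv, hv'⟩ := exists_scaled hU hr
      (fun k => if k = i then Units.mk0 (c / c0) (div_ne_zero hc hc0) else 1)
    have : root hij.ne c = v := by
      apply Units.ext
      ext k l
      rw [hv', hr', root_apply]
      by_cases hk : k = i
      · by_cases hl : l = i
        · subst hk; subst hl
          simp [hij.ne]
          field_simp
        · subst hk
          by_cases hlj : l = j
          · subst hlj
            simp [one_ij, hij.ne']
            field_simp
          · simp [Matrix.one_apply_ne (Ne.symm hl), hlj]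
      · by_cases hl : l = i
        · subst hl
          simp [hk]
        · simp [hk, hl]
    rw [this]; exact hv

/-- A normal pattern subgroup consists of the unipotent upper triangular matrices with support in an
up-set of positions. -/
theorem IsNormalPattern.exists_upset {U : Subgroup (GL (Fin n) F)} (hU : IsNormalPattern U) :
    ∃ D : Fin n → Fin n → Prop, (∀ i j, D i j → i < j) ∧
      (∀ i i' j j', i' ≤ i → j ≤ j' → D i j → D i' j') ∧
      ∀ g : GL (Fin n) F, g ∈ U ↔ ∀ i j, (g.1 - 1) i j ≠ 0 → D i j := by
  have key : ∀ u ∈ U, ∀ (i j : Fin n) (hij : i < j), u.1 i j ≠ 0 → ∀ c : F, root hij.ne c ∈ U := by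
    intro u hu i j hij hne c
    by_cases hF : ∃ s : Fˣ, s ≠ 1
    · obtain ⟨s, hs⟩ := hF
      exact root_mem_of_torus hU.le_UT hU.torus hs hu hij hne c
    · push Not at hF
      have h2 : Nat.card F = 2 := by
        rw [Nat.card_eq_two_iff]
        refine ⟨0, 1, zero_ne_one, Set.eq_univ_of_forall fun x => ?_⟩
        by_cases hx : x = 0
        · exact Or.inl hx
        · right
          have := congrArg Units.val (hF (Units.mk0 x hx))
          simpa using this
      obtain ⟨D, hD⟩ := hU.pattern h2
      rw [hD _ (root_mem_UT hij c)]
      intro k l hkl hne'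
      rw [root_apply, Matrix.one_apply_ne hkl.ne, zero_add] at hne'
      split_ifs at hne' with h'
      · rw [h'.1, h'.2]
        exact (hD u (hU.le_UT hu)).1 hu i j hij hne
      · exact absurd rfl hne'
  let D : Fin n → Fin n → Prop := fun i j => ∃ hij : i < j, ∀ c : F, root hij.ne c ∈ U
  -- Commutators of root elements of `U` with those of `UT` stay in `U` by normality; they move a
  -- position up here, and to the right in `hright`.
  have hleft : ∀ i i' j, i' ≤ i → D i j → D i' j := by
    rintro i i' j hi ⟨hij, h⟩
    rcases hi.eq_or_lt with rfl | hi
    · exact ⟨hij, h⟩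
    · refine ⟨hi.trans hij, fun c => ?_⟩
      rw [show c = c * 1 by ring, ← commutator_root hi.ne hij.ne (hi.trans hij).ne,
        commutatorElement_def]
      exact mul_mem ((Subgroup.mem_normalizer_iff.1 (hU.normal (root_mem_UT hi c)) _).1 (h 1))
        (inv_mem (h 1))
  have hright : ∀ i j j', j ≤ j' → D i j → D i j' := by
    rintro i j j' hj ⟨hij, h⟩
    rcases hj.eq_or_lt with rfl | hj
    · exact ⟨hij, h⟩
    · refine ⟨hij.trans hj, fun c => ?_⟩
      rw [show c = c * 1 by ring, ← commutator_root hij.ne hj.ne (hij.trans hj).ne,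
        commutatorElement_def, mul_assoc, mul_assoc, ← mul_assoc (root hj.ne (1 : F))]
      exact mul_mem (h c)
        ((Subgroup.mem_normalizer_iff.1 (hU.normal (root_mem_UT hj 1)) _).1 (inv_mem (h c)))
  refine ⟨D, fun i j h => h.1, fun i i' j j' hi hj h => hleft _ _ _ hi (hright _ _ _ hj h),
    fun g => ⟨fun hg i j hij => ?_, fun hg => ?_⟩⟩
  · have hlt : i < j := mem_unipotentOf.1 (hU.le_UT hg) i j hij
    refine ⟨hlt, key g hg i j hlt ?_⟩
    rwa [Matrix.sub_apply, Matrix.one_apply_ne hlt.ne, sub_zero] at hij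
  · refine mem_of_root_mem (mem_unipotentOf.2 fun i j hij => (hg i j hij).1) fun i j hij hne => ?_
    refine (hg i j ?_).2
    rwa [Matrix.sub_apply, Matrix.one_apply_ne hij.ne, sub_zero]

end Pattern

/-- The linear character `γ_η` of a pattern subgroup on whose commutator subgroup it is trivial. -/
theorem exists_monoidHom_gamma {F : Type*} [Field F] [Finite F] {n : ℕ} {ϑ : AddChar F ℂ}
    (hϑ : ϑ ≠ 1) {U : Subgroup (GL (Fin n) F)} {D : Fin n → Fin n → Prop}
    (hDlt : ∀ i j, D i j → i < j)
    (hD : ∀ g : GL (Fin n) F, g ∈ U ↔ ∀ i j, (g.1 - 1) i j ≠ 0 → D i j) (η : SetPartition n)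
    (hb : ∀ g ∈ ⁅U, U⁆, η.γ ϑ g = 1) :
    ∃ γU : U →* ℂ, ∀ g : U, γU g = η.γ ϑ (g : GL (Fin n) F) := by
  have hroot : ∀ (i j : Fin n) (hij : D i j) (c : F), root (hDlt i j hij).ne c ∈ U := by
    intro i j hij c
    rw [hD]
    intro k l hkl
    rw [Matrix.sub_apply, root_apply, add_sub_cancel_left] at hkl
    split_ifs at hkl with h'
    · rw [h'.1, h'.2]; exact hij
    · exact absurd rfl hkl
  -- If an arc (i, k) split through j inside D, the commutator of the two root elements would be 1 +
  -- a e_{ik}, on which γ_η takes the value ϑ(a) ≠ 1. Without such splittings the entries at arcs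
  -- are additive.
  have hno : ∀ p ∈ η.arcs, ∀ j, D p.1 j → D j p.2 → False := by
    rintro ⟨i, k⟩ hp j hij hjk
    obtain ⟨a, ha⟩ := AddChar.ne_one_iff.1 hϑ
    have hik : i ≠ k := (η.lt _ hp).ne
    have hmem := Subgroup.commutator_mem_commutator (hroot i j hij a) (hroot j k hjk 1)
    rw [commutator_root _ _ hik, mul_one] at hmem
    have h1 := hb _ hmem
    rw [SetPartition.γ, Finset.prod_eq_single_of_mem _ hp] at h1
    · rw [root_apply, Matrix.one_apply_ne hik] at h1
      simp only [and_self, if_true, zero_add] at h1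
      exact ha h1
    · rintro ⟨i', k'⟩ hq hne
      rw [root_apply, Matrix.one_apply_ne (η.lt _ hq).ne, if_neg, add_zero, AddChar.map_zero_eq_one]
      rintro ⟨h, h'⟩
      exact hne (Prod.ext h h')
  refine ⟨⟨⟨fun g => η.γ ϑ (g : GL (Fin n) F), ?_⟩, ?_⟩, fun g => rfl⟩
  · refine Finset.prod_eq_one fun p hp => ?_
    simp [(η.lt p hp).ne]
  · intro u v
    change η.γ ϑ (u * v : U) = η.γ ϑ u * η.γ ϑ v
    rw [SetPartition.γ, SetPartition.γ, SetPartition.γ, ← Finset.prod_mul_distrib]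
    refine Finset.prod_congr rfl fun p hp => ?_
    rw [← AddChar.map_add_eq_mul]
    congr 1
    have e : ((u * v : U) : GL (Fin n) F).1 - 1
        = (u.1.1 - 1) * (v.1.1 - 1) + (u.1.1 - 1) + (v.1.1 - 1) := by
      rw [Subgroup.coe_mul, Units.val_mul]; noncomm_ring
    have e' := congrFun (congrFun e p.1) p.2
    have z : ((u.1.1 - 1) * (v.1.1 - 1)) p.1 p.2 = 0 := by
      by_contra h
      obtain ⟨j, h1, h2⟩ := exists_ne_zero_of_mul h
      exact hno p hp j ((hD _).1 u.2 _ _ h1) ((hD _).1 v.2 _ _ h2)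
    simpa [z, Matrix.one_apply_ne (η.lt p hp).ne] using e'

/-- A non-nesting set partition with arcs in an up-set `D` of positions admits a grading in which the
arcs have degree one, and all positions outside of `D` have degree less than one. -/
theorem exists_grading {n : ℕ} (η : SetPartition n) (hη : η.NonNesting)
    {D : Fin n → Fin n → Prop} (hup : ∀ i i' j j', i' ≤ i → j ≤ j' → D i j → D i' j')
    (harc : ∀ i j, η.Arc i j → D i j) :
    ∃ d : Fin n → ℚ, (∀ i j, η.Arc i j → d j = d i + 1) ∧
      ∀ i j, ¬ D i j → d j - d i < 1 := by
  classical
  -- R collects the pairs that must satisfy d j < d i + 1: those outside D, those lying strictly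
  -- before the end of an arc from i, and whatever these force through monotonicity of d.
  let R : Fin n → Fin n → Prop := fun i j =>
    ∃ i' j', i' ≤ i ∧ j ≤ j' ∧ (¬ D i' j' ∨ ∃ k, η.Arc i' k ∧ j' < k)
  have hR1 : ∀ i j j', R i j → j' ≤ j → R i j' := by
    rintro i j j' ⟨x, y, hx, hy, h⟩ hj
    exact ⟨x, y, hx, hj.trans hy, h⟩
  have hR2 : ∀ i i' j, R i j → i ≤ i' → R i' j := by
    rintro i i' j ⟨x, y, hx, hy, h⟩ hi
    exact ⟨x, y, hx.trans hi, hy, h⟩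
  have hR3 : ∀ i j k, η.Arc i k → (R i j ↔ j < k) := by
    intro i j k hik
    constructor
    · rintro ⟨x, y, hx, hy, h | ⟨k', hk', hyk⟩⟩
      · by_contra hkj
        exact h (hup _ _ _ _ hx ((not_lt.1 hkj).trans hy) (harc i k hik))
      · rcases hx.eq_or_lt with rfl | hx
        · have : k = k' := (η.inj _ hik _ hk').1 rfl
          exact this ▸ hy.trans_lt hyk
        · by_contra hkj
          exact hη x i k k' hk' hik ⟨hx, η.lt _ hik, ((not_lt.1 hkj).trans hy).trans_lt hyk⟩
    · exact fun hjk => ⟨i, j, le_rfl, le_rfl, Or.inr ⟨k, hik, hjk⟩⟩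
  -- The weights are chosen from left to right, strictly increasing, subject to the constraints in R
  -- among the indices already treated.
  have key : ∀ m : ℕ, ∃ d : Fin n → ℚ, (∀ i j : Fin n, (j : ℕ) < m → i < j → d i < d j) ∧
      (∀ i j : Fin n, (i : ℕ) < m → (j : ℕ) < m → R i j → d j < d i + 1) ∧
      ∀ i j : Fin n, (j : ℕ) < m → η.Arc i j → d j = d i + 1 := by
    intro m
    induction m with
    | zero => exact ⟨0, by simp, by simp, by simp⟩
    | succ m ih =>
      obtain ⟨d, hmono, hd1, hd2⟩ := ih
      by_cases hm : m < n
      swap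
      · refine ⟨d, fun i j _ => hmono i j (by omega), fun i j _ _ => hd1 i j (by omega) (by omega),
          fun i j _ => hd2 i j (by omega)⟩
      let x : Fin n := ⟨m, hm⟩
      obtain ⟨v, hv1, hv2, hv3⟩ : ∃ v : ℚ, (∀ j < x, d j < v) ∧ (∀ i < x, R i x → v < d i + 1) ∧
          ∀ i, η.Arc i x → v = d i + 1 := by
        -- An incoming arc i → x forces the value d i + 1. It exceeds the earlier d j since R i j
        -- holds, and R i' x forces i < i', hence d i < d i'.
        by_cases hx : ∃ i, η.Arc i x
        · obtain ⟨i, hi⟩ := hx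
          have hix : i < x := η.lt _ hi
          refine ⟨d i + 1, fun j hj => hd1 i j hix hj ((hR3 i j x hi).2 hj), ?_, ?_⟩
          · intro i' hi' hRx
            have : i < i' := by
              by_contra h
              exact lt_irrefl x ((hR3 i x x hi).1 (hR2 _ _ _ hRx (not_lt.1 h)))
            linarith [hmono i i' hi' this]
          · intro i' hi'
            have : i = i' := (η.inj _ hi _ hi').2 rfl
            rw [this]
        -- Without an incoming arc, the lower bounds lie below the upper ones because R i x implies
        -- R i j for j < x; density of ℚ gives a value in between.
        · obtain ⟨v, h1, h2⟩ := Order.exists_between_finsets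
            ((univ.filter fun j => j < x).image d)
            ((univ.filter fun i => i < x ∧ R i x).image fun i => d i + 1) (by
              simp only [mem_image, mem_filter, mem_univ, true_and]
              rintro _ ⟨j, hj, rfl⟩ _ ⟨i, ⟨hi, hRi⟩, rfl⟩
              exact hd1 i j hi hj (hR1 _ _ _ hRi hj.le))
          simp only [mem_image, mem_filter, mem_univ, true_and, forall_exists_index, and_imp,
            forall_apply_eq_imp_iff₂] at h1 h2
          exact ⟨v, h1, fun i hi hRi => h2 _ i hi hRi rfl, fun i hi => absurd ⟨i, hi⟩ hx⟩
      have hlt : ∀ i : Fin n, (i : ℕ) < m + 1 → i ≠ x → (i : ℕ) < m := by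
        intro i hi hne
        have : (i : ℕ) ≠ m := fun h => hne (Fin.ext h)
        omega
      refine ⟨Function.update d x v, ?_, ?_, ?_⟩
      · intro i j hj hij
        by_cases hjx : j = x
        · subst hjx
          rw [Function.update_self, Function.update_of_ne hij.ne]
          exact hv1 i hij
        · have := hlt j hj hjx
          have hix : i ≠ x := fun h => by
            subst h; exact absurd (Fin.lt_def.1 hij) (not_lt.2 this.le)
          rw [Function.update_of_ne hjx, Function.update_of_ne hix]
          exact hmono i j this hij
      · intro i j hi hj hij
        by_cases hjx : j = x
        · subst hjx
          rw [Function.update_self]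
          by_cases hix : i = x
          · subst hix
            rw [Function.update_self]; linarith
          · rw [Function.update_of_ne hix]
            exact hv2 i (hlt i hi hix) hij
        · have hjm := hlt j hj hjx
          rw [Function.update_of_ne hjx]
          by_cases hix : i = x
          · subst hix
            rw [Function.update_self]
            linarith [hv1 j hjm]
          · rw [Function.update_of_ne hix]
            exact hd1 i j (hlt i hi hix) hjm hij
      · intro i j hj hij
        by_cases hjx : j = x
        · subst hjx
          rw [Function.update_self, Function.update_of_ne (η.lt _ hij).ne]
          exact hv3 i hij
        · have hjm := hlt j hj hjx
          have hix : i ≠ x := fun h => by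
            subst h; exact absurd (Fin.lt_def.1 (η.lt _ hij)) (not_lt.2 hjm.le)
          rw [Function.update_of_ne hjx, Function.update_of_ne hix]
          exact hd2 i j hjm hij
  obtain ⟨d, -, hd1, hd2⟩ := key n
  refine ⟨d, fun i j => hd2 i j j.2, fun i j hij => ?_⟩
  linarith [hd1 i j i.2 j.2 ⟨i, j, le_rfl, le_rfl, Or.inl hij⟩]

/-! ### Numberings of the cells of a Ferrers diagram -/

theorem exists_equiv_of_map_eq {α β γ : Type*} [Fintype α] [Fintype β] (f : α → γ) (g : β → γ)
    (h : (univ : Finset α).val.map f = (univ : Finset β).val.map g) :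
    ∃ e : α ≃ β, ∀ x, g (e x) = f x := by
  classical
  have hc : ∀ c, Nonempty ({x // f x = c} ≃ {y // g y = c}) := by
    intro c
    refine ⟨Fintype.equivOfCardEq ?_⟩
    have := congrArg (Multiset.count c) h
    rw [Multiset.count_map, Multiset.count_map] at this
    rw [Fintype.card_subtype, Fintype.card_subtype]
    simpa only [Finset.card_def, Finset.filter_val, eq_comm] using this
  exact ⟨Equiv.ofFiberEquiv fun c => (hc c).some, fun x => Equiv.ofFiberEquiv_map _ x⟩

/-- The vertex `x` is placed in the cell `e x` of the diagram `μ`, in such a way that the arcs of `η`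
join the cells next to each other in a row. -/
structure IsCellNumbering {n : ℕ} (η : SetPartition n) (μ : YoungDiagram) (e : Fin n → ℕ × ℕ) :
    Prop where
  injective : Function.Injective e
  mem : ∀ x, e x ∈ μ
  surj : ∀ c ∈ μ, ∃ x, e x = c
  arc_iff : ∀ x y, η.Arc x y ↔ (e x).1 = (e y).1 ∧ (e x).2 + 1 = (e y).2

namespace IsCellNumbering

variable {n : ℕ} {η : SetPartition n} {μ : YoungDiagram} {e : Fin n → ℕ × ℕ}

theorem isPaths (he : IsCellNumbering η μ e) : IsPaths η.Arc fun x => (e x).2 where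
  right_unique {x y z} h h' := by
    rw [he.arc_iff] at h h'
    exact he.injective (Prod.ext (h.1.symm.trans h'.1) (h.2.symm.trans h'.2))
  left_unique {x y z} h h' := by
    rw [he.arc_iff] at h h'
    exact he.injective (Prod.ext (h.1.trans h'.1.symm) (by omega))
  depth {x y} h := ((he.arc_iff x y).1 h).2.symm
  pred {y} h := by
    have hy : ((e y).1, (e y).2) ∈ μ := he.mem y
    obtain ⟨x, hx⟩ := he.surj ((e y).1, (e y).2 - 1) (μ.up_left_mem le_rfl (Nat.sub_le _ _) hy)
    refine ⟨x, (he.arc_iff x y).2 ?_⟩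
    rw [hx]
    exact ⟨rfl, by simp only; omega⟩

theorem lt_rowLen (he : IsCellNumbering η μ e) (x : Fin n) : (e x).2 < μ.rowLen (e x).1 :=
  YoungDiagram.mem_iff_lt_rowLen.1 (he.mem x)

theorem forall_not_arc_iff (he : IsCellNumbering η μ e) (x : Fin n) :
    (∀ z, ¬ η.Arc x z) ↔ (e x).2 + 1 = μ.rowLen (e x).1 := by
  have hx := he.lt_rowLen x
  constructor
  · intro h
    by_contra hne
    obtain ⟨z, hz⟩ := he.surj ((e x).1, (e x).2 + 1)
      (YoungDiagram.mem_iff_lt_rowLen.2 (by omega))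
    exact h z ((he.arc_iff x z).2 (by simp [hz]))
  · intro h z hz
    have h1 := (he.arc_iff x z).1 hz
    have h2 := he.lt_rowLen z
    rw [← h1.1] at h2
    omega

/-- Two set partitions with numberings by the same diagram differ by a permutation. -/
theorem exists_perm (he : IsCellNumbering η μ e) {η' : SetPartition n} {e' : Fin n → ℕ × ℕ}
    (he' : IsCellNumbering η' μ e') : ∃ π : Equiv.Perm (Fin n), ∀ x, e' (π x) = e x := by
  choose f hf using fun x => he'.surj (e x) (he.mem x)
  have hinj : Function.Injective f := fun x y h => he.injective (by rw [← hf x, ← hf y, h])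
  exact ⟨Equiv.ofBijective f (Finite.injective_iff_bijective.1 hinj), hf⟩

end IsCellNumbering

/-! ### The blocks of a set partition -/

/-- Every vertex has a depth and an initial vertex in its block. -/
theorem exists_depth {n : ℕ} (η : SetPartition n) : ∃ (a : Fin n → ℕ) (s : Fin n → Fin n),
    (∀ x y, η.Arc x y → a y = a x + 1 ∧ s y = s x) ∧
      ∀ y, (∀ x, ¬ η.Arc x y) → a y = 0 ∧ s y = y := by
  classical
  let step : ∀ y : Fin n, (∀ x, x < y → ℕ × Fin n) → ℕ × Fin n := fun y ih =>
    if h : ∃ x, η.Arc x y then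
      ((ih h.choose (η.lt _ h.choose_spec)).1 + 1, (ih h.choose (η.lt _ h.choose_spec)).2)
    else (0, y)
  let wf : WellFounded fun x y : Fin n => x < y := wellFounded_lt
  have hfix : ∀ y, wf.fix step y = step y fun x _ => wf.fix step x := fun y => wf.fix_eq step y
  refine ⟨fun y => (wf.fix step y).1, fun y => (wf.fix step y).2, ?_, ?_⟩
  · intro x y hxy
    have h : ∃ x, η.Arc x y := ⟨x, hxy⟩
    have hx : h.choose = x := (η.inj _ h.choose_spec _ hxy).2 rfl
    have : wf.fix step y = ((wf.fix step h.choose).1 + 1, (wf.fix step h.choose).2) := by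
      rw [hfix y]
      exact dif_pos h
    rw [hx] at this
    constructor <;> simp only [this]
  · intro y hy
    have : wf.fix step y = (0, y) := by
      rw [hfix y]
      exact dif_neg (by simpa using hy)
    exact ⟨congrArg Prod.fst this, congrArg Prod.snd this⟩

open Classical in
/-- A union of paths is described by the diagram of the partition formed by their sizes. -/
theorem exists_isCellNumbering {n : ℕ} (η : SetPartition n) :
    ∃ e, IsCellNumbering η (diagram η.bl) e := by
  obtain ⟨a, s, hstep, hstart⟩ := exists_depth η
  have hpred : ∀ y, a y ≠ 0 → ∃ x, η.Arc x y := by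
    intro y hy
    by_contra h
    push Not at h
    exact hy (hstart y h).1
  have hinj : ∀ k x y, a x = k → a y = k → s x = s y → x = y := by
    intro k
    induction k with
    | zero =>
      intro x y hx hy hs
      have h0 : ∀ z, a z = 0 → s z = z := fun z hz =>
        (hstart z fun w hw => by have := (hstep w z hw).1; omega).2
      rw [← h0 x hx, ← h0 y hy, hs]
    | succ k ih =>
      intro x y hx hy hs
      obtain ⟨x', hx'⟩ := hpred x (by omega)
      obtain ⟨y', hy'⟩ := hpred y (by omega)
      obtain ⟨h1, h2⟩ := hstep _ _ hx'
      obtain ⟨h3, h4⟩ := hstep _ _ hy'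
      have : x' = y' := ih x' y' (by omega) (by omega) (by rw [← h2, ← h4, hs])
      subst this
      exact (η.inj _ hx' _ hy').1 rfl
  have hrel : ∀ x y, η.setoid x y ↔ s x = s y := by
    intro x y
    constructor
    · intro h
      change Relation.EqvGen _ x y at h
      induction h with
      | rel x y h => exact (hstep x y h).2.symm
      | refl x => rfl
      | symm x y _ ih => exact ih.symm
      | trans x y z _ _ ih1 ih2 => exact ih1.trans ih2
    · intro h
      have hs : ∀ k y, a y = k → η.setoid (s y) y := by
        intro k
        induction k with
        | zero =>
          intro y hy
          rw [(hstart y fun w hw => by have := (hstep w y hw).1; omega).2]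
        | succ k ih =>
          intro y hy
          obtain ⟨x, hx⟩ := hpred y (by omega)
          obtain ⟨h1, h2⟩ := hstep _ _ hx
          rw [h2]
          exact η.setoid.trans (ih x (by omega)) (Relation.EqvGen.rel _ _ hx)
      have h1 := hs _ x rfl
      have h2 := hs _ y rfl
      rw [h] at h1
      exact η.setoid.trans (η.setoid.symm h1) h2
  set P := Finpartition.ofSetoid η.setoid with hP
  set w := η.bl.parts.sort (· ≥ ·) with hw
  have hmem : ∀ x y, y ∈ P.part x ↔ s y = s x := by
    intro x y
    rw [hP, Finpartition.mem_part_ofSetoid_iff_rel, hrel]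
    exact eq_comm
  have hdown : ∀ x k, k ≤ a x → ∃ y, s y = s x ∧ a y = k := by
    intro x k hk
    induction hm : a x - k generalizing x with
    | zero => exact ⟨x, rfl, by omega⟩
    | succ m ih =>
      obtain ⟨x', hx'⟩ := hpred x (by omega)
      obtain ⟨h1, h2⟩ := hstep _ _ hx'
      obtain ⟨y, hy, hy'⟩ := ih x' (by omega) (by omega)
      exact ⟨y, by rw [hy, h2], hy'⟩
  -- On a block, depth is injective and its values are closed downwards, so they form an initial
  -- segment, just like the columns of a row.
  have himg : ∀ x, (P.part x).image a = range #(P.part x) := by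
    intro x
    have hcard : #((P.part x).image a) = #(P.part x) :=
      Finset.card_image_of_injOn fun y hy z hz h =>
        hinj _ y z h rfl (((hmem x y).1 hy).trans ((hmem x z).1 hz).symm)
    refine Finset.eq_of_subset_of_card_le ?_ (by rw [hcard, card_range])
    intro k hk
    obtain ⟨y, hy, rfl⟩ := mem_image.1 hk
    rw [mem_range, ← hcard]
    have : range (a y + 1) ⊆ (P.part x).image a := by
      intro j hj
      obtain ⟨z, hz, hz'⟩ := hdown y j (by have := mem_range.1 hj; omega)
      exact mem_image.2 ⟨z, (hmem x z).2 (hz.trans ((hmem x y).1 hy)), hz'⟩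
    have := card_le_card this
    rw [card_range] at this
    omega
  have hparts : η.bl.parts = P.parts.val.map Finset.card := by
    change Multiset.filter _ (P.parts.val.map Finset.card) = _
    rw [Multiset.filter_eq_self]
    intro k hk
    obtain ⟨B, hB, rfl⟩ := Multiset.mem_map.1 hk
    exact (Finset.card_pos.2 (P.nonempty_of_mem_parts hB)).ne'
  -- A size-preserving bijection from the blocks to the rows; blocks of equal size may be matched
  -- arbitrarily.
  obtain ⟨f, hf⟩ := exists_equiv_of_map_eq (fun B : P.parts => #B.1) w.get (by
    rw [Fin.univ_val_map, List.ofFn_get, hw, Multiset.sort_eq, hparts]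
    have := Multiset.attach_map_val P.parts.val
    conv_rhs => rw [← this]
    rw [Multiset.map_map]
    rfl)
  let row : Fin n → Fin w.length := fun x => f ⟨P.part x, P.part_mem.2 (mem_univ x)⟩
  have hrow : ∀ x y, row x = row y ↔ s x = s y := by
    intro x y
    rw [f.injective.eq_iff, Subtype.mk.injEq]
    constructor
    · intro h
      rw [← hmem y x, ← h, hmem]
    · intro h
      exact P.part_eq_of_mem (P.part_mem.2 (mem_univ y)) ((hmem y x).2 h)
  have hmu : ∀ (r : Fin w.length) (k : ℕ), ((r : ℕ), k) ∈ diagram η.bl ↔ k < w.get r := by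
    intro r k
    rw [diagram, YoungDiagram.mem_ofRowLens]
    simp [← hw]
  refine ⟨fun x => (row x, a x), ?_, ?_, ?_, ?_⟩
  · intro x y h
    obtain ⟨h1, h2⟩ := Prod.mk.inj h
    exact hinj _ x y h2 rfl ((hrow x y).1 (Fin.ext h1))
  · intro x
    rw [hmu, hf, ← mem_range, ← himg]
    exact mem_image_of_mem _ ((hmem x x).2 rfl)
  · rintro ⟨r, k⟩ hc
    have hr : r < w.length := by
      rw [diagram, YoungDiagram.mem_ofRowLens] at hc
      exact hc.1
    rw [hmu ⟨r, hr⟩] at hc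
    obtain ⟨⟨B, hB⟩, hBr⟩ := f.surjective ⟨r, hr⟩
    obtain ⟨x, hx⟩ := P.nonempty_of_mem_parts hB
    have hBx : P.part x = B := P.part_eq_of_mem hB hx
    rw [← hBr, hf] at hc
    simp only at hc
    rw [← hBx, ← mem_range, ← himg] at hc
    obtain ⟨y, hy, rfl⟩ := mem_image.1 hc
    refine ⟨y, Prod.ext ?_ rfl⟩
    have h1 : row y = row x := (hrow y x).2 ((hmem x y).1 hy)
    have h2 : row x = ⟨r, hr⟩ := by
      rw [← hBr]
      exact congrArg f (Subtype.ext hBx)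
    change ((row y : Fin _) : ℕ) = r
    rw [h1, h2]
  · intro x y
    constructor
    · intro h
      obtain ⟨h1, h2⟩ := hstep x y h
      exact ⟨congrArg Fin.val ((hrow x y).2 h2.symm), h1.symm⟩
    · rintro ⟨h1, h2⟩
      simp only at h1 h2
      obtain ⟨x', hx'⟩ := hpred y (by omega)
      obtain ⟨h3, h4⟩ := hstep _ _ hx'
      have : x' = x := hinj _ x' x (by omega) rfl (h4.symm.trans ((hrow x y).1 (Fin.ext h1)).symm)
      rwa [← this]

/-- The reading order gives a numbering of the cells for `ggg(λ)`. -/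
theorem exists_isCellNumbering_ggg {n : ℕ} (lam : n.Partition) :
    ∃ e, IsCellNumbering (ggg lam) (diagram lam) e ∧
      ∀ x : Fin n, (x : ℕ) = cellNum (diagram lam) (e x) := by
  set μ := diagram lam with hμ
  let num : {c // c ∈ μ.cells} → Fin n := fun c =>
    ⟨cellNum μ c.1, by simpa [hμ, card_diagram] using cellNum_lt_card c.2⟩
  have hinj : Function.Injective num := fun c d h =>
    Subtype.ext (cellNum_inj c.2 d.2 (congrArg Fin.val h))
  have hbij : Function.Bijective num :=
    (Fintype.bijective_iff_injective_and_card num).2 ⟨hinj, by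
      rw [Fintype.card_coe, card_diagram, Fintype.card_fin]⟩
  let e := (Equiv.ofBijective num hbij).symm
  have he : ∀ x : Fin n, (x : ℕ) = cellNum μ (e x).1 := fun x =>
    congrArg Fin.val ((Equiv.ofBijective num hbij).apply_symm_apply x).symm
  refine ⟨fun x => (e x).1, ⟨?_, fun x => (e x).2, ?_, ?_⟩, he⟩
  · exact fun x y h => e.injective (Subtype.ext h)
  · intro c hc
    exact ⟨num ⟨c, hc⟩, congrArg Subtype.val ((Equiv.ofBijective num hbij).symm_apply_apply ⟨c, hc⟩)⟩
  · intro x y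
    have : (ggg lam).Arc x y ↔ IsGggArc lam x y := by
      simp [SetPartition.Arc, ggg]
    rw [this, IsGggArc, he x, he y]
    constructor
    · rintro ⟨r, k, h, hx, hy⟩
      rw [cellNum_inj (e x).2 (mem_of_succ_mem h) hx, cellNum_inj (e y).2 h hy]
      exact ⟨rfl, rfl⟩
    · rintro ⟨h1, h2⟩
      have hy : (e y).1 = ((e x).1.1, (e x).1.2 + 1) := Prod.ext h1.symm h2.symm
      exact ⟨(e x).1.1, (e x).1.2, hy ▸ (e y).2, rfl, by rw [hy]⟩

theorem IsCellNumbering.card_row_lt {n : ℕ} {η : SetPartition n} {μ : YoungDiagram}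
    {e : Fin n → ℕ × ℕ} (he : IsCellNumbering η μ e) (r m : ℕ) :
    #{z : Fin n | (e z).1 = r ∧ (e z).2 < m} = min (μ.rowLen r) m := by
  rw [← card_range (min _ _)]
  refine Finset.card_bij (fun z _ => (e z).2) ?_ ?_ ?_
  · intro z hz
    simp only [mem_filter, mem_univ, true_and] at hz
    have := he.lt_rowLen z
    rw [hz.1] at this
    rw [mem_range]
    omega
  · intro z hz z' hz' h
    simp only [mem_filter, mem_univ, true_and] at hz hz'
    exact he.injective (Prod.ext (hz.1.trans hz'.1.symm) h)
  · intro k hk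
    rw [mem_range, lt_min_iff] at hk
    obtain ⟨z, hz⟩ := he.surj (r, k) (YoungDiagram.mem_iff_lt_rowLen.2 hk.1)
    exact ⟨z, by simp [hz, hk.2], by rw [hz]⟩

theorem IsCellNumbering.card_col {n : ℕ} {η : SetPartition n} {μ : YoungDiagram}
    {e : Fin n → ℕ × ℕ} (he : IsCellNumbering η μ e) (s : ℕ) :
    #{z : Fin n | (e z).2 = s} = μ.colLen s := by
  rw [← card_range (μ.colLen s)]
  refine Finset.card_bij (fun z _ => (e z).1) ?_ ?_ ?_
  · intro z hz
    simp only [mem_filter, mem_univ, true_and] at hz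
    rw [mem_range, ← YoungDiagram.mem_iff_lt_colLen, ← hz]
    exact he.mem z
  · intro z hz z' hz' h
    simp only [mem_filter, mem_univ, true_and] at hz hz'
    exact he.injective (Prod.ext h (hz.trans hz'.symm))
  · intro r hr
    rw [mem_range, ← YoungDiagram.mem_iff_lt_colLen] at hr
    obtain ⟨z, hz⟩ := he.surj (r, s) hr
    exact ⟨z, by simp [hz], by rw [hz]⟩

/-! ### Slice positions and the blocks of a composition -/

theorem card_index_eq {n : ℕ} (α : Composition n) (k : Fin α.length) :
    #{z : Fin n | α.index z = k} = α.blocksFun k := by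
  rw [← Finset.card_fin (α.blocksFun k), ← Finset.card_map (α.embedding k).toEmbedding]
  congr 1
  ext z
  simp only [mem_filter, mem_univ, true_and, mem_map]
  have := α.mem_range_embedding_iff' (j := z) (i := k)
  rw [Set.mem_range] at this
  rw [eq_comm]
  exact this.symm

/-- If the arcs increase the index of the block of `α`, whose blocks are the columns of the diagram in
some order, then the positions of the slice weakly decrease it. -/
theorem IsCellNumbering.index_le {n : ℕ} {η : SetPartition n} {μ : YoungDiagram}
    {e : Fin n → ℕ × ℕ} (he : IsCellNumbering η μ e) (α : Composition n)
    (hα : α.blocks.Perm μ.transpose.rowLens) (harc : ∀ x y, η.Arc x y → α.index x < α.index y)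
    {x y : Fin n} (hxy : IsSlicePos η.Arc (fun x => (e x).2) (x, y)) : α.index y ≤ α.index x := by
  classical
  obtain ⟨hend, hle⟩ := hxy
  simp only at hend hle
  rw [he.forall_not_arc_iff] at hend
  -- Since x ends its path, m is the full length of the row of x.
  set m := (e x).2 + 1 with hm
  have hinc : ∀ k z w, (e z).1 = (e w).1 → (e w).2 = (e z).2 + (k + 1) → α.index z < α.index w := by
    intro k
    induction k with
    | zero => exact fun z w h1 h2 => harc z w ((he.arc_iff z w).2 ⟨h1, h2.symm⟩)
    | succ k ih =>
      intro z w h1 h2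
      obtain ⟨v, hv⟩ := he.isPaths.pred (y := w) (show (e w).2 ≠ 0 by omega)
      have hv' := (he.arc_iff v w).1 hv
      exact (ih z v (h1.trans hv'.1.symm) (by omega)).trans (harc v w hv)
  have hinc' : ∀ z w, (e z).1 = (e w).1 → (e z).2 < (e w).2 → α.index z < α.index w := by
    intro z w h1 h2
    exact hinc ((e w).2 - (e z).2 - 1) z w h1 (by omega)
  have hinj : ∀ z w, (e z).1 = (e w).1 → α.index z = α.index w → z = w := by
    intro z w h1 h2
    rcases lt_trichotomy (e z).2 (e w).2 with h | h | h
    · exact absurd h2 (hinc' z w h1 h).ne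
    · exact he.injective (Prod.ext h1 h)
    · exact absurd h2 (hinc' w z h1.symm h).ne'
  obtain ⟨f, hf⟩ := exists_equiv_of_map_eq (fun k : Fin α.length => α.blocksFun k)
    μ.transpose.rowLens.get (by
      rw [Fin.univ_val_map, Fin.univ_val_map, List.ofFn_get, Multiset.coe_eq_coe]
      exact (List.ofFn_get α.blocks) ▸ hα)
  have hlen : μ.transpose.rowLens.length = μ.rowLen 0 := by
    rw [YoungDiagram.length_rowLens, YoungDiagram.colLen_transpose]
  have hf' : ∀ k, α.blocksFun k = μ.colLen (f k) := by
    intro k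
    rw [← hf, ← YoungDiagram.rowLen_transpose]
    simp
  have hm0 : m ≤ μ.rowLen 0 := hend ▸ μ.rowLen_anti 0 _ (Nat.zero_le _)
  -- T is the set of blocks of α matched with the first m columns, so T and these columns contain
  -- equally many vertices.
  set T : Finset (Fin α.length) := {k | ((f k : Fin _) : ℕ) < m} with hT
  have hTbij : ∀ g : ℕ → ℕ, ∑ k ∈ T, g (f k) = ∑ s ∈ range m, g s := by
    intro g
    refine Finset.sum_bij (fun k _ => ((f k : Fin _) : ℕ)) ?_ ?_ ?_ ?_
    · intro k hk
      simpa [hT] using hk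
    · intro k _ k' _ h
      exact f.injective (Fin.ext h)
    · intro s hs
      rw [mem_range] at hs
      refine ⟨f.symm ⟨s, by omega⟩, by simp [hT, hs], by simp⟩
    · intro k _; rfl
  have hTcard : #T = m := by
    have := hTbij fun _ => 1
    simpa using this
  have hAB : #{z : Fin n | α.index z ∈ T} = #{z : Fin n | (e z).2 < m} := by
    rw [Finset.card_eq_sum_card_fiberwise (f := α.index) (t := T) (by intro z hz; simpa using hz),
      Finset.card_eq_sum_card_fiberwise (s := {z : Fin n | (e z).2 < m}) (f := fun z => (e z).2)
        (t := range m) (by intro z hz; simpa using hz), ← hTbij]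
    refine Finset.sum_congr rfl fun k hk => ?_
    have hk' : ((f k : Fin _) : ℕ) < m := by simpa [hT] using hk
    rw [Finset.filter_filter, Finset.filter_filter]
    have e1 : (univ.filter fun z => α.index z ∈ T ∧ α.index z = k) =
        univ.filter fun z => α.index z = k := by
      ext z
      simp only [mem_filter, mem_univ, true_and, and_iff_right_iff_imp]
      rintro rfl
      exact hk
    have e2 : (univ.filter fun z => (e z).2 < m ∧ (e z).2 = f k) =
        univ.filter fun z => (e z).2 = f k := by
      ext z
      simp only [mem_filter, mem_univ, true_and, and_iff_right_iff_imp]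
      intro h
      omega
    rw [e1, e2, card_index_eq, he.card_col, hf']
  -- A row meets each block at most once, so it meets T in at most min(row length, m) vertices. As
  -- the totals agree (`hAB`), equality holds in every row.
  have hrow : ∀ r, #{z : Fin n | (e z).1 = r ∧ α.index z ∈ T} ≤
      #{z : Fin n | (e z).1 = r ∧ (e z).2 < m} := by
    intro r
    rw [he.card_row_lt, le_min_iff]
    constructor
    · have := he.card_row_lt r (μ.rowLen r)
      rw [min_self] at this
      rw [← this]
      refine Finset.card_le_card fun z hz => ?_
      simp only [mem_filter, mem_univ, true_and] at hz ⊢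
      exact ⟨hz.1, hz.1 ▸ he.lt_rowLen z⟩
    · rw [← hTcard]
      refine Finset.card_le_card_of_injOn α.index ?_ ?_
      · intro z hz
        simp only [coe_filter, mem_univ, true_and, Set.mem_ofPred_eq] at hz
        exact hz.2
      · intro z hz w hw h
        simp only [coe_filter, mem_univ, true_and, Set.mem_ofPred_eq] at hz hw
        exact hinj z w (hz.1.trans hw.1.symm) h
  have hrow_eq : ∀ z : Fin n, #{w : Fin n | (e w).1 = (e z).1 ∧ α.index w ∈ T} =
      #{w : Fin n | (e w).1 = (e z).1 ∧ (e w).2 < m} := by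
    rw [Finset.card_eq_sum_card_fiberwise (f := fun z => (e z).1)
        (t := univ.image fun z => (e z).1) (by intro z _; simp),
      Finset.card_eq_sum_card_fiberwise (s := {z : Fin n | (e z).2 < m}) (f := fun z => (e z).1)
        (t := univ.image fun z => (e z).1) (by intro z _; simp)] at hAB
    simp only [Finset.filter_filter, and_comm (b := (e _).1 = _)] at hAB
    have := (Finset.sum_eq_sum_iff_of_le fun r _ => hrow r).1 hAB
    exact fun z => this _ (mem_image_of_mem _ (mem_univ z))
  -- The row of x has exactly m vertices, so it meets every block of T and nothing else; its last
  -- vertex x lies in the last block of T.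
  have hTle : ∀ t ∈ T, t ≤ α.index x := by
    have h1 : #{w : Fin n | (e w).1 = (e x).1 ∧ α.index w ∈ T} = m := by
      rw [hrow_eq, he.card_row_lt, ← hend, min_self]
    have h2 : ({w : Fin n | (e w).1 = (e x).1 ∧ α.index w ∈ T} : Finset (Fin n)).image α.index = T := by
      refine Finset.eq_of_subset_of_card_le ?_ ?_
      · intro t ht
        obtain ⟨w, hw, rfl⟩ := mem_image.1 ht
        exact (mem_filter.1 hw).2.2
      · rw [Finset.card_image_of_injOn, h1, hTcard]
        intro z hz w hw h
        simp only [coe_filter, mem_univ, true_and, Set.mem_ofPred_eq] at hz hw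
        exact hinj z w (hz.1.trans hw.1.symm) h
    intro t ht
    rw [← h2] at ht
    obtain ⟨w, hw, rfl⟩ := mem_image.1 ht
    have hw1 := (mem_filter.1 hw).2.1
    have hw2 := he.lt_rowLen w
    rw [hw1, ← hend] at hw2
    rcases (Nat.le_of_lt_succ hw2).eq_or_lt with h | h
    · rw [he.injective (Prod.ext hw1 h)]
    · exact (hinc' w x hw1 h).le
  -- If y lay beyond all of T, the vertices of its row in T would precede y and so be among the
  -- first m columns, but y itself is in these columns and not in T. This contradicts equality in
  -- the row of y.
  by_contra hlt
  rw [not_le] at hlt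
  refine absurd (hrow_eq y) (ne_of_lt (Finset.card_lt_card
    ((Finset.ssubset_iff_of_subset ?_).2 ⟨y, ?_, ?_⟩)))
  · intro z hz
    simp only [mem_filter, mem_univ, true_and] at hz ⊢
    refine ⟨hz.1, ?_⟩
    by_contra h
    have hzy : α.index z < α.index y := (hTle _ hz.2).trans_lt hlt
    rcases Nat.lt_or_ge (e y).2 (e z).2 with h' | h'
    · exact lt_asymm hzy (hinc' y z hz.1.symm h')
    · omega
  · simp only [mem_filter, mem_univ, true_and]
    omega
  · simp only [mem_filter, mem_univ, true_and]
    exact fun h => absurd (hTle _ h) (not_le.2 hlt)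

/-- In the diagram with permuted columns, the positions of the slice weakly decrease the column. -/
theorem index_le_of_isSlicePos_ggg {n : ℕ} (lam : n.Partition) {e : Fin n → ℕ × ℕ}
    (he : IsCellNumbering (ggg lam) (diagram lam) e)
    (hnum : ∀ x : Fin n, (x : ℕ) = cellNum (diagram lam) (e x))
    {x y : Fin n} (hxy : IsSlicePos (ggg lam).Arc (fun x => (e x).2) (x, y)) :
    (ctrComp lam).index y ≤ (ctrComp lam).index x := by
  obtain ⟨hend, hle⟩ := hxy
  simp only at hend hle
  rw [he.forall_not_arc_iff] at hend
  rw [Fin.le_def, index_cellNum lam (he.mem x) x (hnum x), index_cellNum lam (he.mem y) y (hnum y)]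
  -- A longer row starts no later and ends no earlier in the shifted diagram. If the row of y is at
  -- least as long as that of x, compare starts and use the bound on depth; otherwise compare ends.
  have h1 := he.lt_rowLen y
  have h2 := (diagram lam).rowLen_anti 0 (e x).1 (Nat.zero_le _)
  have h3 := (diagram lam).rowLen_anti 0 (e y).1 (Nat.zero_le _)
  simp only [shiftCol]
  omega

/-! ### Comparison of the two induced characters -/

-- The right-hand side no longer involves W: the sum over conjugates in the pattern group depends
-- only on the paths and their slice.
open Classical in
theorem sum_conj_mul_pow {F : Type*} [Field F] [Fintype F] {n : ℕ} {ϑ : AddChar F ℂ}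
    (hϑ : ϑ ≠ 1) [Fintype (GL (Fin n) F)] {η : SetPartition n} {a : Fin n → ℕ} {d : Fin n → ℚ}
    (h : IsPaths η.Arc a) (hd : ∀ x y, η.Arc x y → d y = d x + 1) {W : Finset (Fin n × Fin n)}
    (hS : ∀ p, IsSlicePos η.Arc a p → p ∈ W) (hW : ∀ p ∈ W, d p.2 - d p.1 < 1)
    (g : GL (Fin n) F) :
    (∑ x : GL (Fin n) F, (if ∀ p ∈ W, ((x * g * x⁻¹ : GL (Fin n) F).1 - 1) p.1 p.2 = 0 then
        η.γ ϑ (x * g * x⁻¹) else 0)) *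
        (Fintype.card F : ℂ) ^ #{p : Fin n × Fin n | IsSlicePos η.Arc a p} =
      ∑ Y ∈ affineOf (arcMatrix F η.Arc) {p : Fin n × Fin n | IsSlicePos η.Arc a p},
        orbitSum ϑ g Y := by
  have h1 := sum_conj_eq_sum_affineOf hϑ η W (fun p hp hpW => by
    have := hW p hpW
    rw [hd p.1 p.2 hp] at this
    linarith) g
  have h2 := sum_affineOf_mul h hd (orbitSum ϑ g) (orbitSum_conj ϑ g) hS hW
  have hq : (Fintype.card F : ℂ) ^ #W ≠ 0 :=
    pow_ne_zero _ (Nat.cast_ne_zero.2 Fintype.card_ne_zero)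
  apply mul_right_cancel₀ hq
  rw [← h2, ← h1]
  ring

end GGG

open Finset in
theorem mainTheorem2 {F : Type*} [Field F] [Finite F] {n : ℕ}
    (ϑ : AddChar F ℂ) (hϑ : ϑ ≠ 1)
    (U : Subgroup (GL (Fin n) F)) (hU : GGG.IsNormalPattern U)
    (η : GGG.SetPartition n) (hη : η.NonNesting)
    (ha : η.u F ∈ U)
    (hb : ∀ g ∈ ⁅U, U⁆, η.γ ϑ g = 1)
    (hc : ∃ α : Composition n,
      α.blocks.Perm (GGG.diagram η.bl).transpose.rowLens ∧ U ≤ GGG.UComp F α) :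
    ∃ γU : U →* ℂ, (∀ g : U, γU g = η.γ ϑ (g : GL (Fin n) F)) ∧
      GGG.indChar U γU =
        ((Nat.card (GGG.UComp F (GGG.ctrComp η.bl)) : ℂ) / (Nat.card U : ℂ)) •
          GGG.Gam ϑ η.bl := by
  classical
  have := Fintype.ofFinite F
  obtain ⟨D, hDlt, hup, hD⟩ := hU.exists_upset
  have harc : ∀ i j, η.Arc i j → D i j := by
    intro i j hij
    refine (hD _).1 ha i j ?_
    have hne : i ≠ j := (η.lt _ hij).ne
    change (1 + Matrix.of (fun i j => if (i, j) ∈ η.arcs then (1 : F) else 0) - 1) i j ≠ 0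
    rw [add_sub_cancel_left, Matrix.of_apply, if_pos (show (i, j) ∈ η.arcs from hij)]
    exact one_ne_zero
  obtain ⟨α, hα, hUα⟩ := hc
  have hDα : ∀ i j, D i j → α.index i < α.index j := by
    intro i j hij
    have hmem : GGG.root (hDlt i j hij).ne (1 : F) ∈ U := by
      rw [hD]
      intro k l hkl
      rw [Matrix.sub_apply, GGG.root_apply, add_sub_cancel_left] at hkl
      split_ifs at hkl with h'
      · rw [h'.1, h'.2]; exact hij
      · exact absurd rfl hkl
    refine GGG.mem_unipotentOf.1 (hUα hmem) i j ?_
    rw [Matrix.sub_apply, GGG.root_apply, add_sub_cancel_left]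
    simp
  obtain ⟨γU, hγU⟩ := GGG.exists_monoidHom_gamma hϑ hDlt hD η hb
  obtain ⟨d, hd1, hd2⟩ := GGG.exists_grading η hη hup harc
  obtain ⟨e, he⟩ := GGG.exists_isCellNumbering η
  obtain ⟨e', he', hnum⟩ := GGG.exists_isCellNumbering_ggg η.bl
  obtain ⟨π, hπ⟩ := he.exists_perm he'
  refine ⟨γU, hγU, ?_⟩
  funext g
  set V := GGG.UComp F (GGG.ctrComp η.bl) with hV
  set W : Finset (Fin n × Fin n) := {p | ¬ D p.1 p.2} with hW
  set W' : Finset (Fin n × Fin n) :=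
    {p | (GGG.ctrComp η.bl).index p.2 ≤ (GGG.ctrComp η.bl).index p.1} with hW'
  -- For `U`: condition (c) keeps the slice outside D, and the weight comes from non-nesting.
  have h1 := GGG.sum_conj_mul_pow hϑ he.isPaths hd1 (W := W)
    (fun p hp => by
      simp only [hW, mem_filter, mem_univ, true_and]
      exact fun hpD => absurd (he.index_le α hα (fun x y h => hDα x y (harc x y h)) hp)
        (not_le.2 (hDα _ _ hpD)))
    (fun p hp => hd2 _ _ (by simpa [hW] using hp)) g
  -- For the group inducing Γ the block index serves as weight: arcs raise it by one, and positions
  -- of W' have degree at most 0.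
  have h2 := GGG.sum_conj_mul_pow hϑ he'.isPaths
    (d := fun x => (((GGG.ctrComp η.bl).index x : ℕ) : ℚ)) (W := W')
    (fun x y h => by
      have := GGG.index_ggg η.bl h
      simp only at this
      rw [this]
      push_cast
      rfl)
    (fun p hp => by
      simp only [hW', mem_filter, mem_univ, true_and]
      exact GGG.index_le_of_isSlicePos_ggg η.bl he' hnum hp)
    (fun p hp => by
      simp only [hW', mem_filter, mem_univ, true_and] at hp
      have : (((GGG.ctrComp η.bl).index p.2 : ℕ) : ℚ) ≤ ((GGG.ctrComp η.bl).index p.1 : ℕ) :=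
        Nat.cast_le.2 hp
      linarith) g
  have hπarc : ∀ x y, (GGG.ggg η.bl).Arc (π x) (π y) ↔ η.Arc x y := by
    intro x y
    rw [he.arc_iff, he'.arc_iff, hπ, hπ]
  have hπS : ∀ x y, GGG.IsSlicePos (GGG.ggg η.bl).Arc (fun x => (e' x).2) (π x, π y) ↔
      GGG.IsSlicePos η.Arc (fun x => (e x).2) (x, y) := by
    intro x y
    simp only [GGG.IsSlicePos, hπ]
    rw [← π.forall_congr_right (q := fun z => ¬ (GGG.ggg η.bl).Arc (π x) z)]
    simp only [hπarc]
  -- The permutation matching the two cell numberings carries arcs to arcs and slice to slice, so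
  -- the two slice sums of a class function agree.
  have hsum := GGG.sum_affineOf_perm (GGG.orbitSum_conj ϑ g) π
    (E := GGG.arcMatrix F η.Arc) (E' := GGG.arcMatrix F (GGG.ggg η.bl).Arc)
    (W := {p | GGG.IsSlicePos η.Arc (fun x => (e x).2) p})
    (W' := {p | GGG.IsSlicePos (GGG.ggg η.bl).Arc (fun x => (e' x).2) p})
    (fun x y => by simp only [GGG.arcMatrix_apply, hπarc])
    (fun x y => by simpa using hπS x y)
  have hcard : #{p : Fin n × Fin n | GGG.IsSlicePos η.Arc (fun x => (e x).2) p} =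
      #{p : Fin n × Fin n | GGG.IsSlicePos (GGG.ggg η.bl).Arc (fun x => (e' x).2) p} := by
    refine Finset.card_equiv (π.prodCongr π) fun p => ?_
    simp only [mem_filter, mem_univ, true_and]
    exact (hπS p.1 p.2).symm
  rw [hsum, ← hcard] at h2
  have key := mul_right_cancel₀
    (pow_ne_zero _ (Nat.cast_ne_zero.2 Fintype.card_ne_zero)) (h1.trans h2.symm)
  have hmemU : ∀ x : GL (Fin n) F, x ∈ U ↔ ∀ p ∈ W, (x.1 - 1) p.1 p.2 = 0 := by
    intro x
    rw [hD]
    simp only [hW, mem_filter, mem_univ, true_and, Prod.forall]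
    exact forall₂_congr fun i j => not_imp_comm
  have hmemV : ∀ x : GL (Fin n) F, x ∈ V ↔ ∀ p ∈ W', (x.1 - 1) p.1 p.2 = 0 := by
    intro x
    rw [hV, GGG.UComp, GGG.mem_unipotentOf]
    simp only [hW', mem_filter, mem_univ, true_and, Prod.forall, ← not_lt (α := Fin _)]
    exact forall₂_congr fun i j => not_imp_comm
  rw [GGG.indChar_apply, Pi.smul_apply, GGG.Gam, GGG.indChar_apply, smul_eq_mul]
  have hA : (∑ x : GL (Fin n) F, if h : x * g * x⁻¹ ∈ U then γU ⟨x * g * x⁻¹, h⟩ else 0) =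
      ∑ x : GL (Fin n) F, if h : x * g * x⁻¹ ∈ V then
        GGG.gammaHom ϑ η.bl ⟨x * g * x⁻¹, h⟩ else 0 := by
    refine (Finset.sum_congr rfl fun x _ => ?_).trans
      (key.trans (Finset.sum_congr rfl fun x _ => ?_))
    · simp only [hmemU, hγU, dite_eq_ite]
    · simp only [hmemV]
      split_ifs <;> rfl
  have hVcard : (Nat.card V : ℂ) ≠ 0 := Nat.cast_ne_zero.2 Nat.card_pos.ne'
  rw [hA, div_mul_eq_mul_div, mul_inv_cancel_left₀ hVcard, div_eq_inv_mul]
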